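/- Let $N\ge 1$, let $\Omega\subset\mathbb R^N$ be a bounded open set, $T>0$, $Q_T=(0,T)\times\Omega$. Let $p\in C^1(\overline\Omega)$ and $1<q<\min_{\overline\Omega}p$. Let $A:\Omega\times\mathbb R^N\to[0,\infty)$ be continuous, differentiable in $\xi$, with $A(x,t\xi)=t^{p(x)}A(x,\xi)$ for all $t\ge 0$, $\xi\in\mathbb R^N$ and a.e. $x\in\Omega$. Set $a(x,\xi)=\frac1{p(x)}\nabla_\xi A(x,\xi)$ and assume that $a(x,0)=0$, that $a\in C^1(\Omega\times(\mathbb R^N\setminus\{0\}))\cap C(\Omega\times\mathbb R^N)$, and that there are constants $\gamma,\Gamma>0$ such that, for all $x\in\Omega$, $\xi\in\mathbb R^N\setminus\{0\}$, $\eta\in\mathbb R^N$, $$\sum_{i,j}\frac{\partial a_j}{\partial\xi_i}(x,\xi)\eta_i\eta_j\ge\gamma|\xi|^{p(x)-2}|\eta|^2,\qquad \sum_{i,j}\Big|\frac{\partial a_j}{\partial\xi_i}(x,\xi)\Big|\le\Gamma|\xi|^{p(x)-2}.$$ Let $f:\overline\Omega\times[0,\infty)\to[0,\infty)$ be continuous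 with $f(x,0)=0$ for $x\in\overline\Omega$, $f>0$ on $\Omega\times(0,\infty)$, and $s\mapsto f(x,s)/s^{q-1}$ nonincreasing on $(0,\infty)$ for every $x\in\Omega$. Write $\mathcal W=W_0^{1,p(x)}(\Omega)$ for the closure of $C_c^\infty(\Omega)$ in $W^{1,p(x)}(\Omega)$. For $h\in L^2(Q_T)$ and $v_0\ge0$ in $L^{2q}(\Omega)$, a weak solution of $$v^{q-1}\partial_t(v^q)-\nabla\cdot a(x,\nabla v)=h\,v^{q-1}+f(x,v)\ \text{ in }Q_T,\quad v=0\ \text{ on }(0,T)\times\partial\Omega,\quad v(0)=v_0 \tag{E}$$ is a function $v\in L^\infty(0,T;\mathcal W)\cap L^\infty(Q_T)$, positive a.e. in $Q_T$, with weak derivative $\partial_t(v^q)\in L^2(Q_T)$, such that for all $\phi\in L^2(Q_T)\cap L^1(0,T;\mathcal W)$ and all $t\in(0,T]$ $$\int_0^t\!\!\int_\Omega\partial_t(v^q)v^{q-1}\phi\,dx\,ds+\int_0^t\!\!\int_\Omega a(x,\nabla v)\cdot\nabla\phi\,dx\,ds=\int_0^t\!\!\int_\Omega\big(h\,v^{q-1}+f(x,v)\big)\phi\,dx\,ds,$$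 and $v(0,\cdot)=v_0$ a.e. in $\Omega$; here $v^q\in H^1(0,T;L^2(\Omega))$ is identified with its representative in $C([0,T];L^2(\Omega))$, and $v\ge 0$. Let $v,w$ be weak solutions of (E) with initial data $v_0,w_0\in L^{2q}(\Omega)$, $v_0,w_0\ge0$, and potentials $h,\tilde h\in L^2(Q_T)$, respectively. Then, for every $t\in[0,T]$, $$\|v^q(t)-w^q(t)\|_{L^2(\Omega)}\le\|v_0^q-w_0^q\|_{L^2(\Omega)}+\int_0^t\|h(s)-\tilde h(s)\|_{L^2(\Omega)}\,ds.$$ -/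

import Mathlib

open MeasureTheory Set Filter Topology
open scoped ENNReal ContDiff

noncomputable section

namespace DNE

/-- `ℝ^N` with its Euclidean norm. -/
abbrev E (N : ℕ) : Type := EuclideanSpace ℝ (Fin N)

/-- Lebesgue measure on the cylinder `Q_T = (0,T) × Ω`. -/
def cylMeasure {N : ℕ} (T : ℝ) (Ω : Set (E N)) : Measure (ℝ × E N) :=
  (volume.restrict (Ioo 0 T)).prod (volume.restrict Ω)

/-- The `i`-th canonical basis vector of `ℝ^N`. -/
def basisVec {N : ℕ} (i : Fin N) : E N := EuclideanSpace.single i (1 : ℝ)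

/-- `p ∈ C¹(closure Ω)`: `p` is continuous on `closure Ω`, differentiable in `Ω`, and its
derivative extends continuously to `closure Ω`. -/
def IsC1Closure {N : ℕ} (Ω : Set (E N)) (p : E N → ℝ) : Prop :=
  ContinuousOn p (closure Ω) ∧
    ∃ D : E N → (E N →L[ℝ] ℝ), ContinuousOn D (closure Ω) ∧ ∀ x ∈ Ω, HasFDerivAt p (D x) x

/-! ### Variable exponent Lebesgue and Sobolev spaces -/

/-- The Luxemburg norm `inf {l > 0 : ∫_Ω (|g(x)| / l)^{p(x)} dx ≤ 1}`, with value `∞` if there is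
no such `l`. -/
def luxNorm {N : ℕ} {F : Type*} [NormedAddCommGroup F] (p : E N → ℝ) (Ω : Set (E N))
    (g : E N → F) : ℝ≥0∞ :=
  ⨅ (l : ℝ) (_ : 0 < l) (_ : ∫⁻ x in Ω, ENNReal.ofReal ((‖g x‖ / l) ^ p x) ≤ 1), ENNReal.ofReal l

/-- `g ∈ L^{p(x)}(Ω)`. -/
def MemLpVar {N : ℕ} {F : Type*} [NormedAddCommGroup F] (p : E N → ℝ) (Ω : Set (E N))
    (g : E N → F) : Prop :=
  AEStronglyMeasurable g (volume.restrict Ω) ∧ luxNorm p Ω g < ⊤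

/-- `η ∈ C_c^∞(Ω)`. -/
def IsTestFunction {N : ℕ} (Ω : Set (E N)) (η : E N → ℝ) : Prop :=
  ContDiff ℝ ∞ η ∧ HasCompactSupport η ∧ tsupport η ⊆ Ω

/-- `G` is the weak gradient of `u` in `Ω`. -/
def IsWeakGradient {N : ℕ} (Ω : Set (E N)) (u : E N → ℝ) (G : E N → E N) : Prop :=
  ∀ η : E N → ℝ, IsTestFunction Ω η → ∀ i : Fin N,
    ∫ x in Ω, u x * fderiv ℝ η x (basisVec i) = -∫ x in Ω, G x i * η x

/-- The norm `‖u‖_{L^{p(x)}} + ‖∇u‖_{L^{p(x)}}` of a function `u` with weak gradient `G`. -/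
def sobNorm {N : ℕ} (p : E N → ℝ) (Ω : Set (E N)) (u : E N → ℝ) (G : E N → E N) : ℝ≥0∞ :=
  luxNorm p Ω u + luxNorm p Ω G

/-- `u ∈ W^{1,p(x)}(Ω)` with weak gradient `G`. -/
def MemW1 {N : ℕ} (p : E N → ℝ) (Ω : Set (E N)) (u : E N → ℝ) (G : E N → E N) : Prop :=
  MemLpVar p Ω u ∧ MemLpVar p Ω G ∧ IsWeakGradient Ω u G

/-- `u ∈ W_0^{1,p(x)}(Ω)` with weak gradient `G`: `u` lies in the closure of `C_c^∞(Ω)` in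
`W^{1,p(x)}(Ω)`. -/
def MemW0 {N : ℕ} (p : E N → ℝ) (Ω : Set (E N)) (u : E N → ℝ) (G : E N → E N) : Prop :=
  MemW1 p Ω u G ∧
    ∃ η : ℕ → E N → ℝ, (∀ n, IsTestFunction Ω (η n)) ∧
      Tendsto (fun n => sobNorm p Ω (fun x => u x - η n x) (fun x => G x - gradient (η n) x))
        atTop (𝓝 0)

/-- `φ ∈ L^r(0,T; W_0^{1,p(x)}(Ω))` with spatial weak gradient `Dφ`. Since `W_0^{1,p(x)}(Ω)` is
separable, strong measurability of `t ↦ φ(t)` amounts to joint measurability of `φ` and `Dφ`. -/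
def MemBochnerW0 {N : ℕ} (r : ℝ≥0∞) (T : ℝ) (p : E N → ℝ) (Ω : Set (E N))
    (φ : ℝ → E N → ℝ) (Dφ : ℝ → E N → E N) : Prop :=
  AEStronglyMeasurable (fun z : ℝ × E N => φ z.1 z.2) (cylMeasure T Ω) ∧
    AEStronglyMeasurable (fun z : ℝ × E N => Dφ z.1 z.2) (cylMeasure T Ω) ∧
    (∀ᵐ t ∂(volume.restrict (Ioo 0 T)), MemW0 p Ω (φ t) (Dφ t)) ∧
    eLpNorm (fun t => sobNorm p Ω (φ t) (Dφ t)) r (volume.restrict (Ioo 0 T)) < ⊤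

/-- `U'` is the weak derivative of `U` with respect to time in `Q_T`. -/
def IsWeakTimeDeriv {N : ℕ} (T : ℝ) (Ω : Set (E N)) (U U' : ℝ → E N → ℝ) : Prop :=
  ∀ ψ : ℝ × E N → ℝ, ContDiff ℝ ∞ ψ → HasCompactSupport ψ → tsupport ψ ⊆ Ioo 0 T ×ˢ Ω →
    ∫ z, U z.1 z.2 * deriv (fun s => ψ (s, z.2)) z.1 ∂(cylMeasure T Ω) =
      -∫ z, U' z.1 z.2 * ψ z ∂(cylMeasure T Ω)

/-- `U ∈ C([0,T]; L²(Ω))`. -/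
def IsContinuousL2 {N : ℕ} (T : ℝ) (Ω : Set (E N)) (U : ℝ → E N → ℝ) : Prop :=
  ∀ t ∈ Icc 0 T, MemLp (U t) 2 (volume.restrict Ω) ∧
    Tendsto (fun s => eLpNorm (fun x => U s x - U t x) 2 (volume.restrict Ω))
      (𝓝[Icc 0 T] t) (𝓝 0)

/-! ### The operator and the source term -/

/-- `a(x,ξ) = (1 / p(x)) ∇_ξ A(x,ξ)`. -/
def fluxField {N : ℕ} (p : E N → ℝ) (A : E N → E N → ℝ) (x ξ : E N) : E N :=
  (1 / p x) • gradient (A x) ξ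

/-- `∂a_j/∂ξ_i (x,ξ)`. -/
def fluxPartial {N : ℕ} (p : E N → ℝ) (A : E N → E N → ℝ) (x ξ : E N) (i j : Fin N) : ℝ :=
  (fderiv ℝ (fun ζ => fluxField p A x ζ) ξ (basisVec i)) j

/-- The potential `A : Ω × ℝ^N → [0,∞)` is continuous, differentiable in `ξ`, `p(x)`-homogeneous
in `ξ`, and satisfies the ellipticity and growth conditions. -/
structure IsLerayLions {N : ℕ} (Ω : Set (E N)) (p : E N → ℝ) (A : E N → E N → ℝ) : Prop where
  nonneg : ∀ x ∈ Ω, ∀ ξ, 0 ≤ A x ξ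
  continuousOn : ContinuousOn (fun z : E N × E N => A z.1 z.2) (Ω ×ˢ univ)
  differentiable : ∀ x ∈ Ω, Differentiable ℝ (A x)
  homogeneous : ∀ᵐ x ∂(volume.restrict Ω), ∀ t : ℝ, 0 ≤ t → ∀ ξ, A x (t • ξ) = t ^ p x * A x ξ
  flux_zero : ∀ x ∈ Ω, fluxField p A x 0 = 0
  flux_continuousOn :
    ContinuousOn (fun z : E N × E N => fluxField p A z.1 z.2) (Ω ×ˢ univ)
  flux_contDiffOn :
    ContDiffOn ℝ 1 (fun z : E N × E N => fluxField p A z.1 z.2) (Ω ×ˢ {0}ᶜ)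
  elliptic : ∃ γ : ℝ, 0 < γ ∧ ∀ x ∈ Ω, ∀ ξ : E N, ξ ≠ 0 → ∀ η : E N,
    γ * ‖ξ‖ ^ (p x - 2) * ‖η‖ ^ 2 ≤ ∑ i, ∑ j, fluxPartial p A x ξ i j * η i * η j
  growth : ∃ Γ : ℝ, 0 < Γ ∧ ∀ x ∈ Ω, ∀ ξ : E N, ξ ≠ 0 →
    ∑ i, ∑ j, |fluxPartial p A x ξ i j| ≤ Γ * ‖ξ‖ ^ (p x - 2)

/-- The source `f : closure Ω × [0,∞) → [0,∞)` is continuous, vanishes at `s = 0`, is positive on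
`Ω × (0,∞)`, and `s ↦ f(x,s) / s^{q-1}` is nonincreasing on `(0,∞)` for every `x ∈ Ω`. -/
structure IsSource {N : ℕ} (Ω : Set (E N)) (q : ℝ) (f : E N → ℝ → ℝ) : Prop where
  continuousOn : ContinuousOn (fun z : E N × ℝ => f z.1 z.2) (closure Ω ×ˢ Ici 0)
  nonneg : ∀ x ∈ closure Ω, ∀ s, 0 ≤ s → 0 ≤ f x s
  zero : ∀ x ∈ closure Ω, f x 0 = 0
  pos : ∀ x ∈ Ω, ∀ s, 0 < s → 0 < f x s
  antitone : ∀ x ∈ Ω, AntitoneOn (fun s => f x s / s ^ (q - 1)) (Ioi 0)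

/-! ### Weak solutions -/

/-- `v` is a weak solution of `v^{q-1} ∂_t(v^q) - ∇·a(x,∇v) = h v^{q-1} + f(x,v)` in `Q_T`, `v = 0`
on `(0,T) × ∂Ω`, `v(0) = v₀`. The function `v^q`, which belongs to `H¹(0,T; L²(Ω))`, is taken in
its representative in `C([0,T]; L²(Ω))`, so that `v(t)` is meaningful for every `t ∈ [0,T]`.
In the definition `Dv` is `∇v` and `V'` is `∂_t(v^q)`. -/
def IsWeakSolution {N : ℕ} (Ω : Set (E N)) (T q : ℝ) (p : E N → ℝ) (A : E N → E N → ℝ)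
    (f : E N → ℝ → ℝ) (h : ℝ → E N → ℝ) (v₀ : E N → ℝ) (v : ℝ → E N → ℝ) : Prop :=
  (∀ᵐ z ∂(cylMeasure T Ω), 0 < v z.1 z.2) ∧
  (∀ t ∈ Icc 0 T, ∀ᵐ x ∂(volume.restrict Ω), 0 ≤ v t x) ∧
  MemLp (fun z : ℝ × E N => v z.1 z.2) ⊤ (cylMeasure T Ω) ∧
  IsContinuousL2 T Ω (fun t x => v t x ^ q) ∧
  (∀ᵐ x ∂(volume.restrict Ω), v 0 x = v₀ x) ∧
  ∃ (Dv : ℝ → E N → E N) (V' : ℝ → E N → ℝ),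
    MemBochnerW0 ⊤ T p Ω v Dv ∧
    MemLp (fun z : ℝ × E N => V' z.1 z.2) 2 (cylMeasure T Ω) ∧
    IsWeakTimeDeriv T Ω (fun t x => v t x ^ q) V' ∧
    ∀ (φ : ℝ → E N → ℝ) (Dφ : ℝ → E N → E N),
      MemLp (fun z : ℝ × E N => φ z.1 z.2) 2 (cylMeasure T Ω) →
      MemBochnerW0 1 T p Ω φ Dφ →
      ∀ t ∈ Ioc 0 T,
        (∫ z, V' z.1 z.2 * v z.1 z.2 ^ (q - 1) * φ z.1 z.2 ∂(cylMeasure t Ω)) +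
          (∫ z, inner ℝ (fluxField p A z.2 (Dv z.1 z.2)) (Dφ z.1 z.2) ∂(cylMeasure t Ω)) =
        ∫ z, (h z.1 z.2 * v z.1 z.2 ^ (q - 1) + f z.2 (v z.1 z.2)) * φ z.1 z.2 ∂(cylMeasure t Ω)

end DNE

end

/-!
The `L²` distance of the `q`-th powers of two solutions is controlled because the operator
`v ↦ -v^{1-q} ∇·a(x,∇v)` is accretive in the variable `v^q`. Formally one tests the equation of `v`
with `(v^q - w^q) / v^{q-1}`, the equation of `w` with `(w^q - v^q) / w^{q-1}`, and adds:

* the time derivatives give `½ d/dt ‖v^q - w^q‖²`;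
* the diffusion terms are nonnegative by a Picone inequality (`picone`). It combines the bound
  `a(x,ξ)·ζ ≤ A(x,ξ)^{1-1/p} A(x,ζ)^{1/p}` (`inner_flux_le`), a consequence of convexity and
  homogeneity of `A(x,·)`, with Young's inequality for the exponent `q < p(x)`;
* the sources are nonpositive since `f(x,s) / s^{q-1}` is nonincreasing;
* the potentials give at most `‖h - h'‖ ‖v^q - w^q‖`, by the Cauchy-Schwarz inequality.

The quotients are not admissible as test functions where `v` or `w` vanishes, so `v` and `w` are
replaced in them by `v + ε` and `w + ε` (`diazSaa`). After multiplication with a cutoff the resulting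
function of `(v,w)` is smooth with compact support in the plane and vanishes at the origin
(`exists_cutoff_diazSaa`), and such functions operate on `W_0^{1,p(x)}` (`MemW0.comp_prodMk`). The
sign of the diffusion terms holds for each `ε` (`tested_inequality`). In the limit `ε → 0` the tested
sources may be unbounded from below, but their positive parts are bounded and tend to zero
(`integral_deriv_le_integral_potential`).

The weak time derivative is turned into the energy identity for `U = v^q - w^q` by representing
`U(·,x)`, for almost every `x`, as the primitive of `∂_t U(·,x)` (`energy_identity`). The resulting
inequality `‖U(t)‖² ≤ ‖U(0)‖² + 2 ∫_0^t ‖h - h'‖ ‖U‖` yields the claim by a Gronwall argument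
(`le_add_integral_of_sq_le`).
-/

namespace DNE

/-! ### The Luxemburg norm -/

section Luxemburg

variable {N : ℕ} {F F' : Type*} [NormedAddCommGroup F] [NormedAddCommGroup F']
  {p : E N → ℝ} {Ω : Set (E N)}

/-- The modular `∫_Ω |g(x)|^{p(x)} dx`. -/
noncomputable def modular (p : E N → ℝ) (Ω : Set (E N)) (g : E N → F) : ℝ≥0∞ :=
  ∫⁻ x in Ω, ENNReal.ofReal (‖g x‖ ^ p x)

theorem luxNorm_le_of_le_one {g : E N → F} {l : ℝ} (hl : 0 < l)
    (h : ∫⁻ x in Ω, ENNReal.ofReal ((‖g x‖ / l) ^ p x) ≤ 1) :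
    luxNorm p Ω g ≤ ENNReal.ofReal l :=
  iInf_le_of_le l (iInf_le_of_le hl (iInf_le _ h))

theorem exists_of_luxNorm_lt {g : E N → F} {a : ℝ≥0∞} (h : luxNorm p Ω g < a) :
    ∃ l : ℝ, 0 < l ∧ ENNReal.ofReal l < a ∧
      ∫⁻ x in Ω, ENNReal.ofReal ((‖g x‖ / l) ^ p x) ≤ 1 := by
  simp only [luxNorm, iInf_lt_iff] at h
  obtain ⟨l, hl, h1, h2⟩ := h
  exact ⟨l, hl, h2, h1⟩

theorem luxNorm_mono_ae {f : E N → F} {g : E N → F'}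
    (hp : ∀ᵐ x ∂volume.restrict Ω, 0 ≤ p x)
    (hfg : ∀ᵐ x ∂volume.restrict Ω, ‖f x‖ ≤ ‖g x‖) : luxNorm p Ω f ≤ luxNorm p Ω g := by
  refine le_of_forall_gt fun a ha => ?_
  obtain ⟨l, hl, hla, h⟩ := exists_of_luxNorm_lt ha
  refine (luxNorm_le_of_le_one hl ((lintegral_mono_ae ?_).trans h)).trans_lt hla
  filter_upwards [hp, hfg] with x hx hx'
  gcongr

theorem luxNorm_const_smul_le [NormedSpace ℝ F] (g : E N → F) {c : ℝ} (hc : 0 < c) :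
    luxNorm p Ω (fun x => c • g x) ≤ ENNReal.ofReal c * luxNorm p Ω g := by
  refine ENNReal.le_mul_of_forall_lt (Or.inl (by simpa using hc)) (Or.inl ENNReal.ofReal_ne_top)
    fun a ha b hb => ?_
  obtain ⟨l, hl, hlb, h⟩ := exists_of_luxNorm_lt hb
  calc luxNorm p Ω (fun x => c • g x) ≤ ENNReal.ofReal (c * l) := by
        refine luxNorm_le_of_le_one (by positivity) (le_of_eq_of_le ?_ h)
        refine lintegral_congr fun x => ?_
        rw [norm_smul, Real.norm_of_nonneg hc.le, mul_div_mul_left _ _ hc.ne']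
    _ = ENNReal.ofReal c * ENNReal.ofReal l := ENNReal.ofReal_mul hc.le
    _ ≤ a * b := by gcongr

/-- The triangle inequality, from the convexity of `s ↦ s ^ p(x)`. -/
theorem luxNorm_add_le {f g : E N → F} (hpm : AEMeasurable p (volume.restrict Ω))
    (hp : ∀ᵐ x ∂volume.restrict Ω, 1 ≤ p x)
    (hf : AEStronglyMeasurable f (volume.restrict Ω)) :
    luxNorm p Ω (fun x => f x + g x) ≤ luxNorm p Ω f + luxNorm p Ω g := by
  refine ENNReal.le_of_forall_pos_le_add fun ε hε hfin => ?_
  have hε2 : (ε : ℝ≥0∞) / 2 ≠ 0 := by simp [hε.ne']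
  have hf' := (ENNReal.add_lt_top.1 hfin).1
  have hg' := (ENNReal.add_lt_top.1 hfin).2
  obtain ⟨l, hl, hla, h⟩ := exists_of_luxNorm_lt (ENNReal.lt_add_right hf'.ne hε2)
  obtain ⟨m, hm, hma, h'⟩ := exists_of_luxNorm_lt (ENNReal.lt_add_right hg'.ne hε2)
  have key : luxNorm p Ω (fun x => f x + g x) ≤ ENNReal.ofReal (l + m) := by
    have hlm : 0 < l + m := by positivity
    refine luxNorm_le_of_le_one hlm ?_
    calc ∫⁻ x in Ω, ENNReal.ofReal ((‖f x + g x‖ / (l + m)) ^ p x)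
        ≤ ∫⁻ x in Ω, (ENNReal.ofReal (l / (l + m)) * ENNReal.ofReal ((‖f x‖ / l) ^ p x) +
            ENNReal.ofReal (m / (l + m)) * ENNReal.ofReal ((‖g x‖ / m) ^ p x)) := by
          refine lintegral_mono_ae ?_
          filter_upwards [hp] with x hx
          rw [← ENNReal.ofReal_mul (by positivity), ← ENNReal.ofReal_mul (by positivity),
            ← ENNReal.ofReal_add (by positivity) (by positivity)]
          refine ENNReal.ofReal_le_ofReal ?_
          have hconv := (convexOn_rpow hx).2
            (mem_Ici.2 (by positivity : 0 ≤ ‖f x‖ / l)) (mem_Ici.2 (by positivity : 0 ≤ ‖g x‖ / m))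
            (by positivity : 0 ≤ l / (l + m)) (by positivity : 0 ≤ m / (l + m))
            (by field_simp)
          simp only [smul_eq_mul] at hconv
          refine le_trans ?_ hconv
          have : l / (l + m) * (‖f x‖ / l) + m / (l + m) * (‖g x‖ / m)
              = (‖f x‖ + ‖g x‖) / (l + m) := by field_simp
          rw [this]
          have := norm_add_le (f x) (g x)
          gcongr
      _ = ENNReal.ofReal (l / (l + m)) * (∫⁻ x in Ω, ENNReal.ofReal ((‖f x‖ / l) ^ p x)) +
            ENNReal.ofReal (m / (l + m)) * ∫⁻ x in Ω, ENNReal.ofReal ((‖g x‖ / m) ^ p x) := by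
          rw [lintegral_add_left', lintegral_const_mul', lintegral_const_mul']
          · exact ENNReal.ofReal_ne_top
          · exact ENNReal.ofReal_ne_top
          · exact (((hf.norm.aemeasurable.div_const l).pow hpm).ennreal_ofReal).const_mul _
      _ ≤ ENNReal.ofReal (l / (l + m)) * 1 + ENNReal.ofReal (m / (l + m)) * 1 := by gcongr
      _ = 1 := by
          rw [mul_one, mul_one, ← ENNReal.ofReal_add (by positivity) (by positivity), ← add_div,
            div_self hlm.ne', ENNReal.ofReal_one]
  refine key.trans ?_
  rw [ENNReal.ofReal_add hl.le hm.le]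
  refine (add_le_add hla.le hma.le).trans (le_of_eq ?_)
  rw [add_add_add_comm, ENNReal.add_halves]

/-- On a set of finite measure the Luxemburg norm controls the `L¹` norm. -/
theorem lintegral_enorm_le_luxNorm {g : E N → F} (hp : ∀ᵐ x ∂volume.restrict Ω, 1 ≤ p x)
    (hΩ : volume Ω ≠ ⊤) :
    ∫⁻ x in Ω, ‖g x‖ₑ ≤ luxNorm p Ω g * (1 + volume Ω) := by
  refine ENNReal.le_mul_of_forall_lt (Or.inr (by finiteness)) (Or.inr (by simp))
    fun a ha b hb => ?_
  obtain ⟨l, hl, hla, h⟩ := exists_of_luxNorm_lt ha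
  calc ∫⁻ x in Ω, ‖g x‖ₑ
      ≤ ∫⁻ x in Ω, ENNReal.ofReal l * (ENNReal.ofReal ((‖g x‖ / l) ^ p x) + 1) := by
        refine lintegral_mono_ae ?_
        filter_upwards [hp] with x hx
        rw [← ofReal_norm, ← ENNReal.ofReal_one,
          ← ENNReal.ofReal_add (by positivity) zero_le_one, ← ENNReal.ofReal_mul hl.le]
        refine ENNReal.ofReal_le_ofReal ?_
        rw [← div_le_iff₀' hl]
        rcases le_total (‖g x‖ / l) 1 with h1 | h1
        · have : 0 ≤ (‖g x‖ / l) ^ p x := by positivity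
          linarith
        · have := Real.self_le_rpow_of_one_le h1 hx
          linarith
    _ = ENNReal.ofReal l * ((∫⁻ x in Ω, ENNReal.ofReal ((‖g x‖ / l) ^ p x)) + volume Ω) := by
        rw [lintegral_const_mul' _ _ ENNReal.ofReal_ne_top, lintegral_add_right _ (by fun_prop)]
        simp
    _ ≤ a * b := by
        gcongr
        refine le_trans ?_ hb.le
        gcongr

/-- The modular is bounded in terms of a bound of the Luxemburg norm. -/
theorem modular_le_of_luxNorm_lt {g : E N → F} {K P : ℝ} (hK : 1 ≤ K)
    (hp : ∀ᵐ x ∂volume.restrict Ω, 0 ≤ p x ∧ p x ≤ P)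
    (h : luxNorm p Ω g < ENNReal.ofReal K) : modular p Ω g ≤ ENNReal.ofReal (K ^ P) := by
  obtain ⟨l, hl, hlK, h⟩ := exists_of_luxNorm_lt h
  have hlK' : l < K := (ENNReal.ofReal_lt_ofReal_iff (by linarith)).1 hlK
  calc modular p Ω g
      ≤ ∫⁻ x in Ω, ENNReal.ofReal (K ^ P) * ENNReal.ofReal ((‖g x‖ / l) ^ p x) := by
        refine lintegral_mono_ae ?_
        filter_upwards [hp] with x hx
        rw [← ENNReal.ofReal_mul (by positivity)]
        refine ENNReal.ofReal_le_ofReal ?_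
        calc ‖g x‖ ^ p x = l ^ p x * (‖g x‖ / l) ^ p x := by
              rw [← Real.mul_rpow hl.le (by positivity), mul_div_cancel₀ _ hl.ne']
          _ ≤ K ^ P * (‖g x‖ / l) ^ p x := by
              gcongr
              exact (Real.rpow_le_rpow hl.le hlK'.le hx.1).trans
                (Real.rpow_le_rpow_of_exponent_le hK hx.2)
    _ = ENNReal.ofReal (K ^ P) * ∫⁻ x in Ω, ENNReal.ofReal ((‖g x‖ / l) ^ p x) :=
        lintegral_const_mul' _ _ ENNReal.ofReal_ne_top
    _ ≤ ENNReal.ofReal (K ^ P) := by simpa using mul_le_mul_right h (ENNReal.ofReal (K ^ P))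

theorem modular_lt_top_of_luxNorm_lt_top {g : E N → F} {P : ℝ}
    (hp : ∀ᵐ x ∂volume.restrict Ω, 0 ≤ p x ∧ p x ≤ P)
    (h : luxNorm p Ω g < ⊤) : modular p Ω g < ⊤ := by
  refine (modular_le_of_luxNorm_lt (K := (luxNorm p Ω g).toReal + 1) (by simp) hp ?_).trans_lt
    ENNReal.ofReal_lt_top
  rw [ENNReal.lt_ofReal_iff_toReal_lt h.ne]
  linarith

/-- Dominated convergence in `L^{p(x)}`: bounded multipliers that tend to `0` almost everywhere
send a fixed function to a null sequence. -/
theorem tendsto_luxNorm_smul_of_tendsto_zero [NormedSpace ℝ F] {g : E N → F} {P C : ℝ}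
    (hpm : AEMeasurable p (volume.restrict Ω))
    (hp : ∀ᵐ x ∂volume.restrict Ω, 1 ≤ p x ∧ p x ≤ P)
    (hg : MemLpVar p Ω g) {c : ℕ → E N → ℝ}
    (hcm : ∀ n, AEStronglyMeasurable (c n) (volume.restrict Ω))
    (hc : ∀ n, ∀ᵐ x ∂volume.restrict Ω, |c n x| ≤ C)
    (hlim : ∀ᵐ x ∂volume.restrict Ω, Tendsto (fun n => c n x) atTop (𝓝 0)) :
    Tendsto (fun n => luxNorm p Ω (fun x => c n x • g x)) atTop (𝓝 0) := by
  refine ENNReal.tendsto_nhds_zero.2 fun ε hε => ?_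
  obtain ⟨l, hl0, hlε⟩ := ENNReal.lt_iff_exists_nnreal_btwn.1 hε
  have hl : (0 : ℝ) < l := by exact_mod_cast hl0
  have hmod := modular_lt_top_of_luxNorm_lt_top (hp.mono fun x hx => ⟨by linarith, hx.2⟩) hg.2
  set D : ℝ := max 1 (C / l) with hD
  have hlim' : Tendsto (fun n => ∫⁻ x in Ω, ENNReal.ofReal ((‖c n x • g x‖ / l) ^ p x)) atTop
      (𝓝 (∫⁻ x in Ω, 0)) := by
    refine tendsto_lintegral_of_dominated_convergence'
      (fun x => ENNReal.ofReal (D ^ P) * ENNReal.ofReal (‖g x‖ ^ p x)) ?_ ?_ ?_ ?_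
    · intro n
      exact ((((hcm n).smul hg.1).norm.aemeasurable.div_const _).pow hpm).ennreal_ofReal
    · intro n
      filter_upwards [hp, hc n] with x hx hcx
      rw [← ENNReal.ofReal_mul (by positivity)]
      refine ENNReal.ofReal_le_ofReal ?_
      have h1 : ‖c n x • g x‖ / l ≤ D * ‖g x‖ := by
        rw [norm_smul, Real.norm_eq_abs, mul_div_right_comm]
        have : |c n x| / l ≤ D := le_trans (by gcongr) (le_max_right _ _)
        gcongr
      calc (‖c n x • g x‖ / l) ^ p x ≤ (D * ‖g x‖) ^ p x :=
            Real.rpow_le_rpow (by positivity) h1 (by linarith)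
        _ = D ^ p x * ‖g x‖ ^ p x := Real.mul_rpow (by positivity) (by positivity)
        _ ≤ D ^ P * ‖g x‖ ^ p x := by
            gcongr
            exacts [le_max_left _ _, hx.2]
    · rw [lintegral_const_mul' _ _ ENNReal.ofReal_ne_top]
      exact (ENNReal.mul_lt_top ENNReal.ofReal_lt_top hmod).ne
    · filter_upwards [hp, hlim] with x hx hcx
      have h1 : Tendsto (fun n => ‖c n x • g x‖ / l) atTop (𝓝 0) := by
        simpa using ((hcx.smul_const (g x)).norm).div_const (l : ℝ)
      have h2 := h1.rpow_const (p := p x) (Or.inr (by linarith))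
      rw [Real.zero_rpow (by linarith)] at h2
      simpa using ENNReal.tendsto_ofReal h2
  rw [lintegral_zero] at hlim'
  filter_upwards [ENNReal.tendsto_nhds_zero.1 hlim' 1 one_pos] with n hn
  refine (luxNorm_le_of_le_one hl hn).trans ?_
  simpa using hlε.le

end Luxemburg

/-! ### Chain rule in `W_0^{1,p(x)}` -/

section ChainRule

variable {N : ℕ} {F : Type*} [NormedAddCommGroup F] {p : E N → ℝ} {Ω : Set (E N)} {P : ℝ}

theorem MemLpVar.integrable {g : E N → F} (hp : ∀ᵐ x ∂volume.restrict Ω, 1 ≤ p x)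
    (hΩ : volume Ω ≠ ⊤) (hg : MemLpVar p Ω g) : Integrable g (volume.restrict Ω) :=
  ⟨hg.1, (lintegral_enorm_le_luxNorm hp hΩ).trans_lt
    (ENNReal.mul_lt_top hg.2 (by finiteness))⟩

/-- Convergence in the Luxemburg norm implies convergence of the integrals against a bounded
function. -/
theorem tendsto_integral_mul_of_tendsto_luxNorm {u b : E N → ℝ} {g : ℕ → E N → ℝ} {C : ℝ}
    (hp : ∀ᵐ x ∂volume.restrict Ω, 1 ≤ p x) (hΩ : volume Ω ≠ ⊤)
    (hu : Integrable u (volume.restrict Ω)) (hg : ∀ n, Integrable (g n) (volume.restrict Ω))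
    (hb : AEStronglyMeasurable b (volume.restrict Ω)) (hbC : ∀ x, ‖b x‖ ≤ C)
    (h : Tendsto (fun n => luxNorm p Ω (fun x => u x - g n x)) atTop (𝓝 0)) :
    Tendsto (fun n => ∫ x in Ω, g n x * b x) atTop (𝓝 (∫ x in Ω, u x * b x)) := by
  have hub := hu.mul_bdd (c := C) hb (Eventually.of_forall hbC)
  refine tendsto_integral_of_L1 _ hub.aestronglyMeasurable
    (Eventually.of_forall fun n => (hg n).mul_bdd (c := C) hb (Eventually.of_forall hbC)) ?_
  have h1 : Tendsto (fun n => ENNReal.ofReal C *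
      (luxNorm p Ω (fun x => u x - g n x) * (1 + volume Ω))) atTop (𝓝 0) := by
    have := ENNReal.Tendsto.const_mul (a := ENNReal.ofReal C)
      (ENNReal.Tendsto.mul_const (b := 1 + volume Ω) h (Or.inr (by finiteness)))
      (Or.inr ENNReal.ofReal_ne_top)
    simpa using this
  refine tendsto_of_tendsto_of_tendsto_of_le_of_le tendsto_const_nhds h1 (fun _ => zero_le) ?_
  intro n
  refine le_trans ?_ (mul_le_mul_right (lintegral_enorm_le_luxNorm hp hΩ) _)
  rw [← lintegral_const_mul' _ _ ENNReal.ofReal_ne_top]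
  refine lintegral_mono fun x => ?_
  have : g n x * b x - u x * b x = b x * (g n x - u x) := by ring
  simp only [this]
  rw [enorm_mul, enorm_sub_rev]
  gcongr
  rw [← ofReal_norm]
  exact ENNReal.ofReal_le_ofReal (hbC x)

theorem gradient_apply (f : E N → ℝ) (x : E N) (i : Fin N) :
    gradient f x i = fderiv ℝ f x (basisVec i) := by
  have h := EuclideanSpace.inner_single_right (𝕜 := ℝ) i (1 : ℝ) (gradient f x)
  rw [basisVec, ← inner_gradient_left, h]
  simp

theorem IsTestFunction.continuous_gradient {η : E N → ℝ} (hη : IsTestFunction Ω η) :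
    Continuous (gradient η) :=
  (InnerProductSpace.toDual ℝ (E N)).symm.continuous.comp
    (hη.1.continuous_fderiv (by simp))

theorem IsTestFunction.hasCompactSupport_gradient {η : E N → ℝ} (hη : IsTestFunction Ω η) :
    HasCompactSupport (gradient η) :=
  (hη.2.1.fderiv (𝕜 := ℝ)).comp_left (g := (InnerProductSpace.toDual ℝ (E N)).symm) (map_zero _)

theorem IsTestFunction.isWeakGradient {η : E N → ℝ} (hη : IsTestFunction Ω η) :
    IsWeakGradient Ω η (gradient η) := by
  intro ψ hψ i
  have h0 : ∀ x, x ∉ Ω → ψ x = 0 := fun x hx =>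
    image_eq_zero_of_notMem_tsupport fun h => hx (hψ.2.2 h)
  have h1 : ∀ x, x ∉ Ω → fderiv ℝ ψ x = 0 := fun x hx =>
    fderiv_of_notMem_tsupport ℝ fun h => hx (hψ.2.2 h)
  rw [setIntegral_eq_integral_of_forall_compl_eq_zero (fun x hx => by simp [h1 x hx]),
    setIntegral_eq_integral_of_forall_compl_eq_zero (fun x hx => by simp [h0 x hx])]
  simp only [gradient_apply]
  have c1 : Continuous fun x => fderiv ℝ η x (basisVec i) :=
    (hη.1.continuous_fderiv (by simp)).clm_apply continuous_const
  have c2 : Continuous fun x => fderiv ℝ ψ x (basisVec i) :=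
    (hψ.1.continuous_fderiv (by simp)).clm_apply continuous_const
  refine integral_mul_fderiv_eq_neg_fderiv_mul_of_integrable ?_ ?_ ?_
    (fun x _ => hη.1.differentiable (by simp) x) (fun x _ => hψ.1.differentiable (by simp) x)
  · exact (c1.mul hψ.1.continuous).integrable_of_hasCompactSupport hψ.2.1.mul_left
  · exact (hη.1.continuous.mul c2).integrable_of_hasCompactSupport hη.2.1.mul_right
  · exact (hη.1.continuous.mul hψ.1.continuous).integrable_of_hasCompactSupport hη.2.1.mul_right

theorem luxNorm_apply_le (hp : ∀ᵐ x ∂volume.restrict Ω, 1 ≤ p x) (G : E N → E N) (i : Fin N) :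
    luxNorm p Ω (fun x => G x i) ≤ luxNorm p Ω G :=
  luxNorm_mono_ae (hp.mono fun x hx => by linarith)
    (Eventually.of_forall fun x => PiLp.norm_apply_le (G x) i)

/-- Weak gradients are stable under convergence in the Sobolev norm. -/
theorem isWeakGradient_of_tendsto {u : E N → ℝ} {G : E N → E N} {η : ℕ → E N → ℝ}
    (hp : ∀ᵐ x ∂volume.restrict Ω, 1 ≤ p x) (hΩ : volume Ω ≠ ⊤)
    (hu : MemLpVar p Ω u) (hG : MemLpVar p Ω G) (hη : ∀ n, IsTestFunction Ω (η n))
    (h1 : Tendsto (fun n => luxNorm p Ω (fun x => u x - η n x)) atTop (𝓝 0))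
    (h2 : Tendsto (fun n => luxNorm p Ω (fun x => G x - gradient (η n) x)) atTop (𝓝 0)) :
    IsWeakGradient Ω u G := by
  intro ψ hψ i
  have c2 : Continuous fun x => fderiv ℝ ψ x (basisVec i) :=
    (hψ.1.continuous_fderiv (by simp)).clm_apply continuous_const
  obtain ⟨C, hC⟩ := c2.bounded_above_of_compact_support (hψ.2.1.fderiv_apply (𝕜 := ℝ) _)
  obtain ⟨C', hC'⟩ := hψ.1.continuous.bounded_above_of_compact_support hψ.2.1
  have t1 := tendsto_integral_mul_of_tendsto_luxNorm hp hΩ (hu.integrable hp hΩ)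
    (fun n => ((hη n).1.continuous.integrable_of_hasCompactSupport (hη n).2.1).integrableOn)
    c2.aestronglyMeasurable hC h1
  have hGi : MemLpVar p Ω fun x => G x i :=
    ⟨(EuclideanSpace.proj i : E N →L[ℝ] ℝ).continuous.comp_aestronglyMeasurable hG.1,
      (luxNorm_apply_le hp G i).trans_lt hG.2⟩
  have h3 : Tendsto (fun n => luxNorm p Ω (fun x => G x i - gradient (η n) x i)) atTop (𝓝 0) :=
    tendsto_of_tendsto_of_tendsto_of_le_of_le tendsto_const_nhds h2 (fun _ => zero_le)
      fun n => luxNorm_apply_le hp (fun x => G x - gradient (η n) x) i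
  have t2 := tendsto_integral_mul_of_tendsto_luxNorm hp hΩ (hGi.integrable hp hΩ)
    (fun n => ((EuclideanSpace.proj i : E N →L[ℝ] ℝ).integrable_comp
      ((hη n).continuous_gradient.integrable_of_hasCompactSupport
        (hη n).hasCompactSupport_gradient).integrableOn))
    hψ.1.continuous.aestronglyMeasurable hC' h3
  refine tendsto_nhds_unique t1 ?_
  have : (fun n => ∫ x in Ω, η n x * fderiv ℝ ψ x (basisVec i)) =
      fun n => -∫ x in Ω, gradient (η n) x i * ψ x :=
    funext fun n => (hη n).isWeakGradient ψ hψ i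
  rw [this]
  exact t2.neg

/-- A sequence converging in the Luxemburg norm has a subsequence converging almost everywhere. -/
theorem exists_subseq_tendsto_ae {u : E N → ℝ} {g : ℕ → E N → ℝ}
    (hp : ∀ᵐ x ∂volume.restrict Ω, 1 ≤ p x) (hΩ : volume Ω ≠ ⊤)
    (hu : AEStronglyMeasurable u (volume.restrict Ω)) (hg : ∀ n, Continuous (g n))
    (h : Tendsto (fun n => luxNorm p Ω (fun x => u x - g n x)) atTop (𝓝 0)) :
    ∃ k : ℕ → ℕ, StrictMono k ∧
      ∀ᵐ x ∂volume.restrict Ω, Tendsto (fun n => g (k n) x) atTop (𝓝 (u x)) := by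
  refine TendstoInMeasure.exists_seq_tendsto_ae
    (tendstoInMeasure_of_tendsto_eLpNorm (p := 1) one_ne_zero
      (fun n => (hg n).aestronglyMeasurable) hu ?_)
  have h1 : Tendsto (fun n => luxNorm p Ω (fun x => u x - g n x) * (1 + volume Ω)) atTop
      (𝓝 0) := by
    simpa using ENNReal.Tendsto.mul_const (b := 1 + volume Ω) h (Or.inr (by finiteness))
  refine tendsto_of_tendsto_of_tendsto_of_le_of_le tendsto_const_nhds h1 (fun _ => zero_le) ?_
  intro n
  simp only [eLpNorm_one_eq_lintegral_enorm]
  refine le_trans (le_of_eq ?_) (lintegral_enorm_le_luxNorm hp hΩ)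
  refine lintegral_congr fun x => ?_
  rw [Pi.sub_apply, enorm_sub_rev]

theorem luxNorm_le_of_norm_le_add {F₁ F₂ : Type*} [NormedAddCommGroup F₁]
    [NormedAddCommGroup F₂] {f : E N → F} {g₁ : E N → F₁} {g₂ : E N → F₂} {L : ℝ} (hL : 0 < L)
    (hpm : AEMeasurable p (volume.restrict Ω)) (hp : ∀ᵐ x ∂volume.restrict Ω, 1 ≤ p x)
    (hg₁ : AEStronglyMeasurable g₁ (volume.restrict Ω))
    (h : ∀ x, ‖f x‖ ≤ L * (‖g₁ x‖ + ‖g₂ x‖)) :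
    luxNorm p Ω f ≤ ENNReal.ofReal L * (luxNorm p Ω g₁ + luxNorm p Ω g₂) := by
  have hp0 : ∀ᵐ x ∂volume.restrict Ω, 0 ≤ p x := hp.mono fun x hx => by linarith
  calc luxNorm p Ω f ≤ luxNorm p Ω (fun x => L • (‖g₁ x‖ + ‖g₂ x‖)) := by
        refine luxNorm_mono_ae hp0 (Eventually.of_forall fun x => ?_)
        rw [smul_eq_mul, Real.norm_of_nonneg (by positivity)]
        exact h x
    _ ≤ ENNReal.ofReal L * luxNorm p Ω (fun x => ‖g₁ x‖ + ‖g₂ x‖) := luxNorm_const_smul_le _ hL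
    _ ≤ ENNReal.ofReal L * (luxNorm p Ω (fun x => ‖g₁ x‖) + luxNorm p Ω (fun x => ‖g₂ x‖)) := by
        gcongr
        exact luxNorm_add_le hpm hp hg₁.norm
    _ ≤ ENNReal.ofReal L * (luxNorm p Ω g₁ + luxNorm p Ω g₂) := by
        gcongr
        · exact luxNorm_mono_ae hp0 (Eventually.of_forall fun x => by simp)
        · exact luxNorm_mono_ae hp0 (Eventually.of_forall fun x => by simp)

theorem tendsto_zero_luxNorm_of_norm_le_add {F₁ F₂ : Type*} [NormedAddCommGroup F₁]
    [NormedAddCommGroup F₂] {f : ℕ → E N → F} {g₁ : ℕ → E N → F₁} {g₂ : ℕ → E N → F₂} {L : ℝ}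
    (hL : 0 < L) (hpm : AEMeasurable p (volume.restrict Ω))
    (hp : ∀ᵐ x ∂volume.restrict Ω, 1 ≤ p x)
    (hg₁ : ∀ n, AEStronglyMeasurable (g₁ n) (volume.restrict Ω))
    (h : ∀ n x, ‖f n x‖ ≤ L * (‖g₁ n x‖ + ‖g₂ n x‖))
    (h₁ : Tendsto (fun n => luxNorm p Ω (g₁ n)) atTop (𝓝 0))
    (h₂ : Tendsto (fun n => luxNorm p Ω (g₂ n)) atTop (𝓝 0)) :
    Tendsto (fun n => luxNorm p Ω (f n)) atTop (𝓝 0) := by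
  have := ENNReal.Tendsto.const_mul (a := ENNReal.ofReal L) (h₁.add h₂)
    (Or.inr ENNReal.ofReal_ne_top)
  rw [add_zero, mul_zero] at this
  exact tendsto_of_tendsto_of_tendsto_of_le_of_le tendsto_const_nhds this (fun _ => zero_le)
    fun n => luxNorm_le_of_norm_le_add hL hpm hp (hg₁ n) (h n)

/-- The gradient of `Φ(u, w)` as given by the chain rule, for functions `u` and `w` with gradients
`Du` and `Dw`. -/
noncomputable def chainGrad (Φ : ℝ × ℝ → ℝ) (u w : E N → ℝ) (Du Dw : E N → E N) (x : E N) : E N :=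
  fderiv ℝ Φ (u x, w x) (1, 0) • Du x + fderiv ℝ Φ (u x, w x) (0, 1) • Dw x

theorem gradient_comp_prodMk {Φ : ℝ × ℝ → ℝ} {u w : E N → ℝ} {x : E N}
    (hΦ : DifferentiableAt ℝ Φ (u x, w x)) (hu : DifferentiableAt ℝ u x)
    (hw : DifferentiableAt ℝ w x) :
    gradient (fun y => Φ (u y, w y)) x = chainGrad Φ u w (gradient u) (gradient w) x := by
  refine ext_inner_right ℝ fun y => ?_
  have h := (hΦ.hasFDerivAt.comp x (hu.hasFDerivAt.prodMk hw.hasFDerivAt)).fderiv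
  have h' : fderiv ℝ (fun y => Φ (u y, w y)) x = _ := h
  rw [inner_gradient_left, h', chainGrad, inner_add_left, inner_smul_left, inner_smul_left,
    inner_gradient_left, inner_gradient_left]
  have : (fderiv ℝ u x y, fderiv ℝ w x y) =
      fderiv ℝ u x y • ((1, 0) : ℝ × ℝ) + fderiv ℝ w x y • ((0, 1) : ℝ × ℝ) := by simp
  simp only [ContinuousLinearMap.comp_apply, ContinuousLinearMap.prod_apply]
  rw [this, map_add, map_smul, map_smul]
  simp [mul_comm]

section

variable {Φ : ℝ × ℝ → ℝ} {L : ℝ}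

theorem abs_sub_le_of_fderiv_le (hΦ : ContDiff ℝ ∞ Φ) (hL0 : 0 < L)
    (hL : ∀ z, ‖fderiv ℝ Φ z‖ ≤ L) (a b c d : ℝ) :
    ‖Φ (a, b) - Φ (c, d)‖ ≤ L * (‖a - c‖ + ‖b - d‖) := by
  have := convex_univ.norm_image_sub_le_of_norm_fderiv_le (𝕜 := ℝ)
    (fun z _ => hΦ.differentiable (by simp) z) (fun z _ => hL z) (mem_univ (c, d)) (mem_univ (a, b))
  refine this.trans ?_
  gcongr
  rw [Prod.mk_sub_mk, Prod.norm_mk]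
  exact max_le_add_of_nonneg (norm_nonneg _) (norm_nonneg _)

theorem norm_fderiv_apply_le (hL : ∀ z, ‖fderiv ℝ Φ z‖ ≤ L) (z : ℝ × ℝ) :
    ‖fderiv ℝ Φ z (1, 0)‖ ≤ L ∧ ‖fderiv ℝ Φ z (0, 1)‖ ≤ L := by
  constructor
  · simpa using (fderiv ℝ Φ z).le_of_opNorm_le (hL z) (1, 0)
  · simpa using (fderiv ℝ Φ z).le_of_opNorm_le (hL z) (0, 1)

theorem norm_chainGrad_le (hL : ∀ z, ‖fderiv ℝ Φ z‖ ≤ L) (u w : E N → ℝ) (Du Dw : E N → E N)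
    (x : E N) : ‖chainGrad Φ u w Du Dw x‖ ≤ L * (‖Du x‖ + ‖Dw x‖) := by
  obtain ⟨h1, h2⟩ := norm_fderiv_apply_le hL (u x, w x)
  calc ‖chainGrad Φ u w Du Dw x‖ ≤ ‖fderiv ℝ Φ (u x, w x) (1, 0)‖ * ‖Du x‖ +
        ‖fderiv ℝ Φ (u x, w x) (0, 1)‖ * ‖Dw x‖ := by
        refine (norm_add_le _ _).trans ?_
        rw [norm_smul, norm_smul]
    _ ≤ L * ‖Du x‖ + L * ‖Dw x‖ := by gcongr
    _ = _ := by ring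

theorem continuous_fderiv_const_apply (hΦ : ContDiff ℝ ∞ Φ) (e : ℝ × ℝ) :
    Continuous fun z => fderiv ℝ Φ z e :=
  (hΦ.continuous_fderiv (by simp)).clm_apply continuous_const

theorem IsTestFunction.comp_prodMk {η ζ : E N → ℝ} (hΦ : ContDiff ℝ ∞ Φ) (h0 : Φ 0 = 0)
    (hη : IsTestFunction Ω η) (hζ : IsTestFunction Ω ζ) :
    IsTestFunction Ω (fun x => Φ (η x, ζ x)) := by
  have hsub : tsupport (fun x => Φ (η x, ζ x)) ⊆ tsupport η ∪ tsupport ζ := by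
    refine closure_minimal (fun x hx => ?_) ((isClosed_tsupport η).union (isClosed_tsupport ζ))
    by_contra hcon
    rw [mem_union, not_or] at hcon
    refine hx ?_
    change Φ (η x, ζ x) = 0
    rw [image_eq_zero_of_notMem_tsupport hcon.1, image_eq_zero_of_notMem_tsupport hcon.2]
    exact h0
  exact ⟨hΦ.comp (hη.1.prodMk hζ.1),
    (hη.2.1.isCompact.union hζ.2.1.isCompact).of_isClosed_subset (isClosed_tsupport _) hsub,
    hsub.trans (union_subset hη.2.2 hζ.2.2)⟩

/-- Smooth functions with bounded derivative that vanish at the origin operate on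
`W_0^{1,p(x)}`. The approximating test functions are the compositions with test functions that
approximate the arguments; their gradients converge by dominated convergence, along a subsequence
on which the arguments converge almost everywhere. -/
theorem MemW0.comp_prodMk {u w : E N → ℝ} {Du Dw : E N → E N}
    (hpm : AEMeasurable p (volume.restrict Ω))
    (hp : ∀ᵐ x ∂volume.restrict Ω, 1 ≤ p x ∧ p x ≤ P) (hΩ : volume Ω ≠ ⊤)
    (hΦ : ContDiff ℝ ∞ Φ) (h0 : Φ 0 = 0) (hL0 : 0 < L) (hL : ∀ z, ‖fderiv ℝ Φ z‖ ≤ L)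
    (hu : MemW0 p Ω u Du) (hw : MemW0 p Ω w Dw) :
    MemW0 p Ω (fun x => Φ (u x, w x)) (chainGrad Φ u w Du Dw) := by
  have hp1 : ∀ᵐ x ∂volume.restrict Ω, 1 ≤ p x := hp.mono fun x hx => hx.1
  obtain ⟨⟨huL, hDuL, -⟩, η, hη, hηt⟩ := hu
  obtain ⟨⟨hwL, hDwL, -⟩, ζ, hζ, hζt⟩ := hw
  have sob₁ : ∀ {u : E N → ℝ} {Du : E N → E N} {η : ℕ → E N → ℝ},
      Tendsto (fun n => sobNorm p Ω (fun x => u x - η n x) (fun x => Du x - gradient (η n) x))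
        atTop (𝓝 0) → Tendsto (fun n => luxNorm p Ω (fun x => u x - η n x)) atTop (𝓝 0) ∧
          Tendsto (fun n => luxNorm p Ω (fun x => Du x - gradient (η n) x)) atTop (𝓝 0) :=
    fun h => ⟨tendsto_of_tendsto_of_tendsto_of_le_of_le tendsto_const_nhds h (fun _ => zero_le)
        fun n => le_self_add,
      tendsto_of_tendsto_of_tendsto_of_le_of_le tendsto_const_nhds h (fun _ => zero_le)
        fun n => le_add_self⟩
  obtain ⟨hη1, hη2⟩ := sob₁ hηt
  obtain ⟨hζ1, hζ2⟩ := sob₁ hζt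
  obtain ⟨k, hk, hkη⟩ := exists_subseq_tendsto_ae hp1 hΩ huL.1 (fun n => (hη n).1.continuous) hη1
  obtain ⟨m, hm, hmζ⟩ := exists_subseq_tendsto_ae hp1 hΩ hwL.1
    (fun n => (hζ (k n)).1.continuous) (hζ1.comp hk.tendsto_atTop)
  have hkm : Tendsto (fun n => k (m n)) atTop atTop := hk.tendsto_atTop.comp hm.tendsto_atTop
  set η' : ℕ → E N → ℝ := fun n => η (k (m n)) with hη'
  set ζ' : ℕ → E N → ℝ := fun n => ζ (k (m n)) with hζ'
  have hη't : ∀ n, IsTestFunction Ω (η' n) := fun n => hη _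
  have hζ't : ∀ n, IsTestFunction Ω (ζ' n) := fun n => hζ _
  have hlim : ∀ᵐ x ∂volume.restrict Ω,
      Tendsto (fun n => (η' n x, ζ' n x)) atTop (𝓝 (u x, w x)) := by
    filter_upwards [hkη, hmζ] with x h1 h2
    exact (h1.comp hm.tendsto_atTop).prodMk_nhds h2
  have hum : AEStronglyMeasurable (fun x => (u x, w x)) (volume.restrict Ω) :=
    huL.1.prodMk hwL.1
  have hval : MemLpVar p Ω (fun x => Φ (u x, w x)) := by
    refine ⟨hΦ.continuous.comp_aestronglyMeasurable hum, ?_⟩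
    refine (luxNorm_le_of_norm_le_add hL0 hpm hp1 huL.1 (g₂ := w) fun x => ?_).trans_lt
      (ENNReal.mul_lt_top ENNReal.ofReal_lt_top (ENNReal.add_lt_top.2 ⟨huL.2, hwL.2⟩))
    have := abs_sub_le_of_fderiv_le hΦ hL0 hL (u x) (w x) 0 0
    have h0' : Φ (0, 0) = 0 := h0
    simpa [h0'] using this
  have hcm : ∀ e, AEStronglyMeasurable (fun x => fderiv ℝ Φ (u x, w x) e) (volume.restrict Ω) :=
    fun e => (continuous_fderiv_const_apply hΦ e).comp_aestronglyMeasurable hum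
  have hgrad : MemLpVar p Ω (chainGrad Φ u w Du Dw) := by
    refine ⟨((hcm _).smul hDuL.1).add ((hcm _).smul hDwL.1), ?_⟩
    exact (luxNorm_le_of_norm_le_add hL0 hpm hp1 hDuL.1 (norm_chainGrad_le hL u w Du Dw)).trans_lt
      (ENNReal.mul_lt_top ENNReal.ofReal_lt_top (ENNReal.add_lt_top.2 ⟨hDuL.2, hDwL.2⟩))
  have htest : ∀ n, IsTestFunction Ω (fun x => Φ (η' n x, ζ' n x)) := fun n =>
    (hη't n).comp_prodMk hΦ h0 (hζ't n)
  have t1 : Tendsto (fun n => luxNorm p Ω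
      (fun x => Φ (u x, w x) - Φ (η' n x, ζ' n x))) atTop (𝓝 0) :=
    tendsto_zero_luxNorm_of_norm_le_add hL0 hpm hp1
      (fun n => huL.1.sub (hη't n).1.continuous.aestronglyMeasurable)
      (fun n x => abs_sub_le_of_fderiv_le hΦ hL0 hL _ _ _ _)
      (hη1.comp hkm) (hζ1.comp hkm)
  -- The difference of the coefficients, which tends to zero boundedly.
  let c : ℝ × ℝ → ℕ → E N → ℝ := fun e n x =>
    fderiv ℝ Φ (u x, w x) e - fderiv ℝ Φ (η' n x, ζ' n x) e
  have hc_meas : ∀ e n, AEStronglyMeasurable (c e n) (volume.restrict Ω) := fun e n =>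
    (hcm e).sub ((continuous_fderiv_const_apply hΦ e).comp
      ((hη't n).1.continuous.prodMk (hζ't n).1.continuous)).aestronglyMeasurable
  have hc_lim : ∀ e, ∀ᵐ x ∂volume.restrict Ω, Tendsto (fun n => c e n x) atTop (𝓝 0) := by
    intro e
    filter_upwards [hlim] with x hx
    have := ((continuous_fderiv_const_apply hΦ e).tendsto _).comp hx
    simpa [c] using (tendsto_const_nhds (x := fderiv ℝ Φ (u x, w x) e)).sub this
  have hc1 : ∀ n x, |c (1, 0) n x| ≤ 2 * L := fun n x => by
    have h1 := (norm_fderiv_apply_le hL (u x, w x)).1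
    have h2 := (norm_fderiv_apply_le hL (η' n x, ζ' n x)).1
    rw [Real.norm_eq_abs] at h1 h2
    exact (abs_sub _ _).trans (by linarith)
  have hc2 : ∀ n x, |c (0, 1) n x| ≤ 2 * L := fun n x => by
    have h1 := (norm_fderiv_apply_le hL (u x, w x)).2
    have h2 := (norm_fderiv_apply_le hL (η' n x, ζ' n x)).2
    rw [Real.norm_eq_abs] at h1 h2
    exact (abs_sub _ _).trans (by linarith)
  have s1 := tendsto_luxNorm_smul_of_tendsto_zero hpm hp hDuL (hc_meas (1, 0))
    (fun n => Eventually.of_forall (hc1 n)) (hc_lim _)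
  have s2 := tendsto_luxNorm_smul_of_tendsto_zero hpm hp hDwL (hc_meas (0, 1))
    (fun n => Eventually.of_forall (hc2 n)) (hc_lim _)
  have s3 : Tendsto (fun n => luxNorm p Ω
      (fun x => c (1, 0) n x • Du x + c (0, 1) n x • Dw x)) atTop (𝓝 0) :=
    tendsto_zero_luxNorm_of_norm_le_add one_pos hpm hp1
      (fun n => (hc_meas _ n).smul hDuL.1) (fun n x => by simpa using norm_add_le _ _) s1 s2
  have s4 : Tendsto (fun n => luxNorm p Ω
      (chainGrad Φ (η' n) (ζ' n) (fun x => Du x - gradient (η' n) x)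
        (fun x => Dw x - gradient (ζ' n) x))) atTop (𝓝 0) :=
    tendsto_zero_luxNorm_of_norm_le_add hL0 hpm hp1
      (fun n => hDuL.1.sub (hη't n).continuous_gradient.aestronglyMeasurable)
      (fun n => norm_chainGrad_le hL _ _ _ _) (hη2.comp hkm) (hζ2.comp hkm)
  have t2 : Tendsto (fun n => luxNorm p Ω (fun x => chainGrad Φ u w Du Dw x -
      gradient (fun y => Φ (η' n y, ζ' n y)) x)) atTop (𝓝 0) := by
    refine tendsto_zero_luxNorm_of_norm_le_add one_pos hpm hp1
      (fun n => ((hc_meas (1, 0) n).smul hDuL.1).add ((hc_meas (0, 1) n).smul hDwL.1))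
      (fun n x => ?_) s3 s4
    rw [gradient_comp_prodMk (hΦ.differentiable (by simp) _)
      ((hη't n).1.differentiable (by simp) x) ((hζ't n).1.differentiable (by simp) x), one_mul]
    refine le_trans (le_of_eq ?_) (norm_add_le _ _)
    congr 1
    simp only [chainGrad, c, Pi.add_apply, Pi.smul_apply']
    module
  refine ⟨⟨hval, hgrad, isWeakGradient_of_tendsto hp1 hΩ hval hgrad htest t1 t2⟩, _, htest, ?_⟩
  simpa [sobNorm] using t1.add t2

end

end ChainRule

/-! ### Homogeneous convex potentials and a Picone inequality -/

section Picone

theorem young_rpow {q X Z : ℝ} (hq : 1 < q) (hX : 0 ≤ X) (hZ : 0 ≤ Z) :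
    q * X * Z ^ (q - 1) ≤ X ^ q + (q - 1) * Z ^ q := by
  have hq1 : 0 < q - 1 := by linarith
  have h := Real.young_inequality_of_nonneg hX (Real.rpow_nonneg hZ (q - 1))
    (Real.HolderConjugate.conjExponent hq)
  rw [Real.conjExponent, ← Real.rpow_mul hZ, mul_div_cancel₀ _ hq1.ne'] at h
  have h2 := mul_le_mul_of_nonneg_left h (by linarith : 0 ≤ q)
  calc q * X * Z ^ (q - 1) = q * (X * Z ^ (q - 1)) := by ring
    _ ≤ _ := h2
    _ = _ := by field_simp

/-- Young's inequality for the exponent `q`, multiplied by `Y ^ (P - q)`. -/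
theorem young_rpow_mul {q P X Y α β : ℝ} (hq : 1 < q) (hqP : q < P) (hX : 0 ≤ X) (hY : 0 ≤ Y)
    (hα : 0 < α) (hβ : 0 < β) :
    q * α ^ (q - 1) * β ^ (1 - q) * (Y ^ (P - 1) * X) ≤
      X ^ q * Y ^ (P - q) + (q - 1) * α ^ q * β ^ (-q) * Y ^ P := by
  have h := mul_le_mul_of_nonneg_right (young_rpow hq hX (by positivity : 0 ≤ Y * (α / β)))
    (Real.rpow_nonneg hY (P - q))
  have e1 : (Y * (α / β)) ^ (q - 1) = Y ^ (q - 1) * (α ^ (q - 1) * β ^ (1 - q)) := by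
    rw [Real.mul_rpow hY (by positivity), Real.div_rpow hα.le hβ.le, div_eq_mul_inv,
      ← Real.rpow_neg hβ.le, neg_sub]
  have e2 : (Y * (α / β)) ^ q = Y ^ q * (α ^ q * β ^ (-q)) := by
    rw [Real.mul_rpow hY (by positivity), Real.div_rpow hα.le hβ.le, div_eq_mul_inv,
      ← Real.rpow_neg hβ.le]
  have e3 : Y ^ (P - 1) = Y ^ (q - 1) * Y ^ (P - q) := by
    rw [← Real.rpow_add_of_nonneg hY (by linarith) (by linarith)]
    ring_nf
  have e4 : Y ^ P = Y ^ q * Y ^ (P - q) := by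
    rw [← Real.rpow_add_of_nonneg hY (by linarith) (by linarith)]
    ring_nf
  rw [e1, e2] at h
  rw [e3, e4]
  calc _ = q * X * (Y ^ (q - 1) * (α ^ (q - 1) * β ^ (1 - q))) * Y ^ (P - q) := by ring
    _ ≤ _ := h
    _ = _ := by ring

/-- The scalar form of the Picone inequality. After Young's inequality what remains is
`(X ^ q - Y ^ q) * (X ^ (P - q) - Y ^ (P - q)) ≥ 0`. -/
theorem picone_scalar {q P X Y α β : ℝ} (hq : 1 < q) (hqP : q < P) (hX : 0 ≤ X) (hY : 0 ≤ Y)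
    (hα : 0 < α) (hβ : 0 < β) :
    q * β ^ (q - 1) * α ^ (1 - q) * (X ^ (P - 1) * Y) +
      q * α ^ (q - 1) * β ^ (1 - q) * (Y ^ (P - 1) * X) ≤
    (1 + (q - 1) * β ^ q * α ^ (-q)) * X ^ P + (1 + (q - 1) * α ^ q * β ^ (-q)) * Y ^ P := by
  have h1 := young_rpow_mul hq hqP hX hY hα hβ
  have h2 := young_rpow_mul hq hqP hY hX hβ hα
  have e : ∀ Z : ℝ, 0 ≤ Z → Z ^ P = Z ^ q * Z ^ (P - q) := fun Z hZ => by
    rw [← Real.rpow_add_of_nonneg hZ (by linarith) (by linarith)]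
    ring_nf
  have h3 : X ^ q * Y ^ (P - q) + Y ^ q * X ^ (P - q) ≤ X ^ P + Y ^ P := by
    rw [e X hX, e Y hY]
    have : 0 ≤ (X ^ q - Y ^ q) * (X ^ (P - q) - Y ^ (P - q)) := by
      rcases le_total X Y with h | h
      · have a1 := Real.rpow_le_rpow hX h (by linarith : 0 ≤ q)
        have a2 := Real.rpow_le_rpow hX h (by linarith : 0 ≤ P - q)
        exact mul_nonneg_of_nonpos_of_nonpos (by linarith) (by linarith)
      · have a1 := Real.rpow_le_rpow hY h (by linarith : 0 ≤ q)
        have a2 := Real.rpow_le_rpow hY h (by linarith : 0 ≤ P - q)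
        exact mul_nonneg (by linarith) (by linarith)
    linarith [this]
  linarith

variable {V : Type*} [NormedAddCommGroup V] [InnerProductSpace ℝ V] [CompleteSpace V]
  {B : V → ℝ} {a : V → V} {P : ℝ}

/-- Euler's identity for a homogeneous potential. -/
theorem inner_flux_self (hP : 1 < P) (hB : Differentiable ℝ B)
    (hhom : ∀ t : ℝ, 0 ≤ t → ∀ ξ, B (t • ξ) = t ^ P * B ξ)
    (ha : ∀ ξ, a ξ = (1 / P) • gradient B ξ) (ξ : V) : inner ℝ (a ξ) ξ = B ξ := by
  have h1 : HasDerivAt (fun t : ℝ => B (t • ξ)) (fderiv ℝ B ξ ξ) 1 := by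
    have h := (hB ((1 : ℝ) • ξ)).hasFDerivAt.comp_hasDerivAt (1 : ℝ)
      ((hasDerivAt_id (1 : ℝ)).smul_const ξ)
    convert! h using 1
    simp
  have h2 : HasDerivAt (fun t : ℝ => t ^ P * B ξ) (P * B ξ) 1 := by
    have h := (Real.hasDerivAt_rpow_const (x := 1) (p := P) (Or.inl one_ne_zero)).mul_const (B ξ)
    simpa using h
  have h3 : (fun t : ℝ => B (t • ξ)) =ᶠ[𝓝 1] fun t => t ^ P * B ξ := by
    filter_upwards [lt_mem_nhds one_pos] with t ht using hhom t ht.le ξ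
  have h4 := h1.unique (h2.congr_of_eventuallyEq h3)
  rw [ha, inner_smul_left, inner_gradient_left, h4]
  simp
  field_simp

theorem flux_smul (hB : Differentiable ℝ B)
    (hhom : ∀ t : ℝ, 0 ≤ t → ∀ ξ, B (t • ξ) = t ^ P * B ξ)
    (ha : ∀ ξ, a ξ = (1 / P) • gradient B ξ) {t : ℝ} (ht : 0 < t) (ξ : V) :
    a (t • ξ) = t ^ (P - 1) • a ξ := by
  have h1 : HasFDerivAt (fun ζ => B (t • ζ)) (t • fderiv ℝ B (t • ξ)) ξ := by
    have h := (hB (t • ξ)).hasFDerivAt.comp ξ ((hasFDerivAt_id ξ).const_smul t)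
    convert! h using 1
    ext η
    simp
  have h2 : HasFDerivAt (fun ζ => B (t • ζ)) (t ^ P • fderiv ℝ B ξ) ξ := by
    simp_rw [hhom t ht.le]
    exact (hB ξ).hasFDerivAt.const_mul _
  have h3 := h1.unique h2
  refine ext_inner_right ℝ fun η => ?_
  have h4 : t * fderiv ℝ B (t • ξ) η = t ^ P * fderiv ℝ B ξ η := by
    simpa using congrArg (fun L => L η) h3
  rw [ha, ha, inner_smul_left, inner_gradient_left, inner_smul_left, inner_smul_left,
    inner_gradient_left, Real.rpow_sub_one ht.ne']
  simp only [conj_trivial]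
  have h5 : fderiv ℝ B (t • ξ) η = t ^ P / t * fderiv ℝ B ξ η := by
    field_simp
    linarith
  rw [h5]
  ring

/-- Euler's identity for the flux, which is homogeneous of degree `P - 1`. -/
theorem fderiv_flux_self (hB : Differentiable ℝ B)
    (hhom : ∀ t : ℝ, 0 ≤ t → ∀ ξ, B (t • ξ) = t ^ P * B ξ)
    (ha : ∀ ξ, a ξ = (1 / P) • gradient B ξ) {ξ : V} (hd : DifferentiableAt ℝ a ξ) :
    fderiv ℝ a ξ ξ = (P - 1) • a ξ := by
  have h1 : HasDerivAt (fun t : ℝ => a (t • ξ)) (fderiv ℝ a ξ ξ) 1 := by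
    have hd' : DifferentiableAt ℝ a ((1 : ℝ) • ξ) := by simpa using hd
    have h := hd'.hasFDerivAt.comp_hasDerivAt (1 : ℝ) ((hasDerivAt_id (1 : ℝ)).smul_const ξ)
    convert! h using 1
    simp
  have h2 : HasDerivAt (fun t : ℝ => t ^ (P - 1) • a ξ) ((P - 1) • a ξ) 1 := by
    have h := (Real.hasDerivAt_rpow_const (x := 1) (p := P - 1)
      (Or.inl one_ne_zero)).smul_const (a ξ)
    simpa using h
  have h3 : (fun t : ℝ => a (t • ξ)) =ᶠ[𝓝 1] fun t => t ^ (P - 1) • a ξ := by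
    filter_upwards [lt_mem_nhds one_pos] with t ht using flux_smul hB hhom ha ht ξ
  exact h1.unique (h2.congr_of_eventuallyEq h3)

/-- The gradient inequality of a convex potential. Convexity along a line follows from the
positivity of the derivative of the flux off the origin, a point that the line meets at most
once. -/
theorem flux_gradient_inequality (hP : 1 < P) (hB : Differentiable ℝ B)
    (ha : ∀ ξ, a ξ = (1 / P) • gradient B ξ) (hac : Continuous a)
    (had : ∀ ξ, ξ ≠ 0 → DifferentiableAt ℝ a ξ)
    (hell : ∀ ξ, ξ ≠ 0 → ∀ η, 0 ≤ inner ℝ (fderiv ℝ a ξ η) η) (ξ d : V) :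
    B ξ + P * inner ℝ (a ξ) d ≤ B (ξ + d) := by
  have hline : ∀ t : ℝ, HasDerivAt (fun t : ℝ => ξ + t • d) d t := fun t => by
    simpa using ((hasDerivAt_id t).smul_const d).const_add ξ
  have hBline : ∀ t : ℝ, HasDerivAt (fun t : ℝ => B (ξ + t • d))
      (P * inner ℝ (a (ξ + t • d)) d) t := fun t => by
    have h := (hB (ξ + t • d)).hasFDerivAt.comp_hasDerivAt t (hline t)
    convert! h using 1
    rw [ha, inner_smul_left, inner_gradient_left]
    simp
    field_simp
  have hmono : Monotone fun t : ℝ => inner ℝ (a (ξ + t • d)) d := by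
    rcases eq_or_ne d 0 with rfl | hd0
    · simpa using monotone_const
    obtain ⟨t₀, ht₀⟩ : ∃ t₀ : ℝ, ∀ t, t ≠ t₀ → ξ + t • d ≠ 0 := by
      by_cases h : ∃ t₀ : ℝ, ξ + t₀ • d = 0
      · obtain ⟨t₀, h0⟩ := h
        refine ⟨t₀, fun t ht h1 => ht ?_⟩
        rw [← h0, add_right_inj] at h1
        exact smul_left_injective ℝ hd0 h1
      · exact ⟨0, fun t _ h1 => h ⟨t, h1⟩⟩
    have hc : Continuous fun t : ℝ => inner ℝ (a (ξ + t • d)) d := by fun_prop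
    have hderiv : ∀ t, t ≠ t₀ → HasDerivAt (fun t : ℝ => inner ℝ (a (ξ + t • d)) d)
        (inner ℝ (fderiv ℝ a (ξ + t • d) d) d) t := fun t ht => by
      have h := (had _ (ht₀ t ht)).hasFDerivAt.comp_hasDerivAt t (hline t)
      simpa using h.inner ℝ (hasDerivAt_const t d)
    have m1 : MonotoneOn (fun t : ℝ => inner ℝ (a (ξ + t • d)) d) (Iic t₀) := by
      refine monotoneOn_of_deriv_nonneg (convex_Iic t₀) hc.continuousOn ?_ ?_
      · intro t ht
        rw [interior_Iic] at ht
        exact (hderiv t ht.ne).differentiableAt.differentiableWithinAt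
      · intro t ht
        rw [interior_Iic] at ht
        rw [(hderiv t ht.ne).deriv]
        exact hell _ (ht₀ t ht.ne) d
    have m2 : MonotoneOn (fun t : ℝ => inner ℝ (a (ξ + t • d)) d) (Ici t₀) := by
      refine monotoneOn_of_deriv_nonneg (convex_Ici t₀) hc.continuousOn ?_ ?_
      · intro t ht
        rw [interior_Ici] at ht
        exact (hderiv t ht.ne').differentiableAt.differentiableWithinAt
      · intro t ht
        rw [interior_Ici] at ht
        rw [(hderiv t ht.ne').deriv]
        exact hell _ (ht₀ t ht.ne') d
    exact m1.Iic_union_Ici m2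
  obtain ⟨c, hc, hceq⟩ := exists_hasDerivAt_eq_slope (fun t : ℝ => B (ξ + t • d))
    (fun t => P * inner ℝ (a (ξ + t • d)) d) one_pos
    (fun t _ => (hBline t).continuousAt.continuousWithinAt) (fun t _ => hBline t)
  have h1 := hmono hc.1.le
  simp only [zero_smul, add_zero, one_smul, sub_zero, div_one] at h1 hceq
  nlinarith

/-- A Hölder inequality for the flux: optimize the gradient inequality over the multiples of `η`. -/
theorem inner_flux_le (hP : 1 < P) (hB : Differentiable ℝ B) (hB0 : ∀ ξ, 0 ≤ B ξ)
    (hhom : ∀ t : ℝ, 0 ≤ t → ∀ ξ, B (t • ξ) = t ^ P * B ξ)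
    (ha : ∀ ξ, a ξ = (1 / P) • gradient B ξ) (hac : Continuous a)
    (had : ∀ ξ, ξ ≠ 0 → DifferentiableAt ℝ a ξ)
    (hell : ∀ ξ, ξ ≠ 0 → ∀ η, 0 ≤ inner ℝ (fderiv ℝ a ξ η) η) (ξ η : V) :
    inner ℝ (a ξ) η ≤ (B ξ ^ (1 / P)) ^ (P - 1) * B η ^ (1 / P) := by
  have hP0 : 0 < P := by linarith
  have key : ∀ l : ℝ, 0 < l → P * l * inner ℝ (a ξ) η ≤ l ^ P * B η + (P - 1) * B ξ := by
    intro l hl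
    have h := flux_gradient_inequality hP hB ha hac had hell ξ (l • η - ξ)
    rw [add_sub_cancel, hhom l hl.le, inner_sub_right, inner_smul_right,
      inner_flux_self hP hB hhom ha] at h
    linarith
  set X := B ξ ^ (1 / P) with hX
  set Y := B η ^ (1 / P) with hY
  have hXP : B ξ = X ^ P := by
    rw [hX, ← Real.rpow_mul (hB0 ξ), one_div_mul_cancel hP0.ne', Real.rpow_one]
  have hYP : B η = Y ^ P := by
    rw [hY, ← Real.rpow_mul (hB0 η), one_div_mul_cancel hP0.ne', Real.rpow_one]
  have hX0 : 0 ≤ X := Real.rpow_nonneg (hB0 ξ) _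
  have hY0 : 0 ≤ Y := Real.rpow_nonneg (hB0 η) _
  -- The choice `l = X / Y` is optimal; the perturbation by `ε` covers vanishing potentials.
  have hε : ∀ ε : ℝ, 0 < ε → inner ℝ (a ξ) η ≤ (X + ε) ^ (P - 1) * (Y + ε) := by
    intro ε hε
    have hXe : 0 < X + ε := by linarith
    have hYe : 0 < Y + ε := by linarith
    have h := key ((X + ε) / (Y + ε)) (by positivity)
    have h1 : ((X + ε) / (Y + ε)) ^ P * B η ≤ (X + ε) ^ P := by
      rw [hYP, Real.div_rpow hXe.le hYe.le, div_mul_eq_mul_div, div_le_iff₀ (by positivity)]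
      gcongr
      linarith
    have h2 : (P - 1) * B ξ ≤ (P - 1) * (X + ε) ^ P := by
      rw [hXP]
      have : 0 ≤ P - 1 := by linarith
      gcongr
      linarith
    have h3 : P * ((X + ε) / (Y + ε)) * inner ℝ (a ξ) η ≤ P * (X + ε) ^ P := by linarith
    have h4 : (X + ε) ^ P = (X + ε) ^ (P - 1) * (X + ε) := by
      rw [Real.rpow_sub_one hXe.ne', div_mul_cancel₀ _ hXe.ne']
    have h5 : P * ((X + ε) / (Y + ε)) * inner ℝ (a ξ) η =
        P * (X + ε) * (inner ℝ (a ξ) η / (Y + ε)) := by ring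
    rw [h4, h5, mul_comm ((X + ε) ^ (P - 1)), ← mul_assoc,
      mul_le_mul_iff_right₀ (by positivity), div_le_iff₀ hYe] at h3
    exact h3
  have hc : Tendsto (fun ε : ℝ => (X + ε) ^ (P - 1) * (Y + ε)) (𝓝[>] 0)
      (𝓝 (X ^ (P - 1) * Y)) := by
    have : Continuous fun ε : ℝ => (X + ε) ^ (P - 1) * (Y + ε) :=
      ((continuous_const.add continuous_id).rpow_const fun _ => Or.inr (by linarith)).mul
        (continuous_const.add continuous_id)
    simpa using (this.tendsto 0).mono_left nhdsWithin_le_nhds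
  exact ge_of_tendsto hc (eventually_nhdsWithin_of_forall fun ε h => hε ε h)

/-- Picone inequality for the test functions `(α ^ q - β ^ q) / α ^ (q - 1)` and
`(β ^ q - α ^ q) / β ^ (q - 1)`, where `ξ` and `ζ` are the gradients of `α` and `β`. -/
theorem picone {q : ℝ} (hq : 1 < q) (hqP : q < P) (hB : Differentiable ℝ B) (hB0 : ∀ ξ, 0 ≤ B ξ)
    (hhom : ∀ t : ℝ, 0 ≤ t → ∀ ξ, B (t • ξ) = t ^ P * B ξ)
    (ha : ∀ ξ, a ξ = (1 / P) • gradient B ξ) (hac : Continuous a)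
    (had : ∀ ξ, ξ ≠ 0 → DifferentiableAt ℝ a ξ)
    (hell : ∀ ξ, ξ ≠ 0 → ∀ η, 0 ≤ inner ℝ (fderiv ℝ a ξ η) η) {α β : ℝ} (hα : 0 < α)
    (hβ : 0 < β) (ξ ζ : V) :
    0 ≤ inner ℝ (a ξ) ((1 + (q - 1) * β ^ q * α ^ (-q)) • ξ +
        (-(q * β ^ (q - 1) * α ^ (1 - q))) • ζ) +
      inner ℝ (a ζ) ((1 + (q - 1) * α ^ q * β ^ (-q)) • ζ +
        (-(q * α ^ (q - 1) * β ^ (1 - q))) • ξ) := by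
  have hP : 1 < P := hq.trans hqP
  have hP0 : 0 < P := by linarith
  have h := picone_scalar hq hqP (Real.rpow_nonneg (hB0 ξ) (1 / P))
    (Real.rpow_nonneg (hB0 ζ) (1 / P)) hα hβ
  have hpow : ∀ ξ, (B ξ ^ (1 / P)) ^ P = B ξ := fun ξ => by
    rw [← Real.rpow_mul (hB0 ξ), one_div_mul_cancel hP0.ne', Real.rpow_one]
  rw [hpow, hpow] at h
  simp only [inner_add_right, inner_smul_right, inner_flux_self hP hB hhom ha]
  have h1 := mul_le_mul_of_nonneg_left (inner_flux_le hP hB hB0 hhom ha hac had hell ξ ζ)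
    (by positivity : 0 ≤ q * β ^ (q - 1) * α ^ (1 - q))
  have h2 := mul_le_mul_of_nonneg_left (inner_flux_le hP hB hB0 hhom ha hac had hell ζ ξ)
    (by positivity : 0 ≤ q * α ^ (q - 1) * β ^ (1 - q))
  linarith

end Picone

/-! ### Growth and monotonicity of the flux -/

section LerayLions

variable {N : ℕ} {Ω : Set (E N)} {p : E N → ℝ} {A : E N → E N → ℝ}

theorem IsLerayLions.continuous_flux (hA : IsLerayLions Ω p A) {x : E N} (hx : x ∈ Ω) :
    Continuous (fluxField p A x) := by
  have h := hA.flux_continuousOn.comp_continuous (f := fun ξ : E N => (x, ξ)) (by fun_prop)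
    (fun ξ => ⟨hx, mem_univ _⟩)
  exact h

theorem IsLerayLions.differentiableAt_flux (hA : IsLerayLions Ω p A) (hΩ : IsOpen Ω) {x : E N}
    (hx : x ∈ Ω) {ξ : E N} (hξ : ξ ≠ 0) : DifferentiableAt ℝ (fluxField p A x) ξ := by
  have h := (hA.flux_contDiffOn.contDiffAt
    ((hΩ.prod isOpen_compl_singleton).mem_nhds (⟨hx, hξ⟩ : (x, ξ) ∈ Ω ×ˢ {0}ᶜ))).differentiableAt
    one_ne_zero
  exact h.comp ξ (by fun_prop : DifferentiableAt ℝ (fun ζ : E N => (x, ζ)) ξ)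

theorem sum_smul_basisVec (η : E N) : ∑ i, η i • basisVec i = η := by
  ext j
  simp [basisVec, Finset.sum_apply, Pi.single_apply]

theorem inner_fderiv_flux (x ξ η : E N) :
    inner ℝ (fderiv ℝ (fluxField p A x) ξ η) η = ∑ i, ∑ j, fluxPartial p A x ξ i j * η i * η j := by
  conv_lhs => rw [← sum_smul_basisVec η]
  rw [map_sum, sum_inner, sum_smul_basisVec]
  refine Finset.sum_congr rfl fun i _ => ?_
  rw [map_smul, inner_smul_left, PiLp.inner_apply, conj_trivial, Finset.mul_sum]
  refine Finset.sum_congr rfl fun j _ => ?_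
  simp only [fluxPartial, RCLike.inner_apply, conj_trivial]
  ring

theorem norm_fderiv_flux_le (x ξ η : E N) :
    ‖fderiv ℝ (fluxField p A x) ξ η‖ ≤ (∑ i, ∑ j, |fluxPartial p A x ξ i j|) * ‖η‖ := by
  conv_lhs => rw [← sum_smul_basisVec η]
  rw [map_sum, Finset.sum_mul]
  refine (norm_sum_le _ _).trans (Finset.sum_le_sum fun i _ => ?_)
  rw [map_smul, norm_smul, mul_comm]
  refine mul_le_mul ?_ (PiLp.norm_apply_le η i) (norm_nonneg _)
    (Finset.sum_nonneg fun _ _ => abs_nonneg _)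
  set y := fderiv ℝ (fluxField p A x) ξ (basisVec i) with hy
  calc ‖y‖ = ‖∑ j, y j • (basisVec j : E N)‖ := by rw [sum_smul_basisVec]
    _ ≤ ∑ j, ‖y j • (basisVec j : E N)‖ := norm_sum_le _ _
    _ = ∑ j, |fluxPartial p A x ξ i j| := by
        refine Finset.sum_congr rfl fun j _ => ?_
        rw [norm_smul, Real.norm_eq_abs]
        simp [basisVec, fluxPartial, hy]

/-- The growth of the flux: by Euler's identity it is controlled by its derivative. -/
theorem IsLerayLions.exists_norm_flux_le (hA : IsLerayLions Ω p A) (hΩ : IsOpen Ω) {q : ℝ}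
    (hq : 1 < q) (hqp : ∀ x ∈ Ω, q < p x) :
    ∃ C : ℝ, 0 < C ∧ ∀ᵐ x ∂volume.restrict Ω, ∀ ξ, ‖fluxField p A x ξ‖ ≤ C * ‖ξ‖ ^ (p x - 1) := by
  obtain ⟨Γ, hΓ, hgr⟩ := hA.growth
  refine ⟨Γ / (q - 1), div_pos hΓ (by linarith), ?_⟩
  filter_upwards [hA.homogeneous, ae_restrict_mem hΩ.measurableSet] with x hhom hx ξ
  have hpx := hqp x hx
  rcases eq_or_ne ξ 0 with rfl | hξ
  · rw [hA.flux_zero x hx, norm_zero, Real.zero_rpow (by linarith), mul_zero]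
  have h1 := fderiv_flux_self (hA.differentiable x hx) hhom
    (a := fluxField p A x) (fun _ => rfl)
    (hA.differentiableAt_flux hΩ hx hξ)
  have h2 := norm_fderiv_flux_le (p := p) (A := A) x ξ ξ
  have hξ' : 0 < ‖ξ‖ := norm_pos_iff.2 hξ
  have h3 : ‖ξ‖ ^ (p x - 1) = ‖ξ‖ ^ (p x - 2) * ‖ξ‖ := by
    rw [← Real.rpow_add_one hξ'.ne']
    ring_nf
  have h4 : (p x - 1) * ‖fluxField p A x ξ‖ ≤ Γ * ‖ξ‖ ^ (p x - 1) := by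
    calc (p x - 1) * ‖fluxField p A x ξ‖ = ‖fderiv ℝ (fluxField p A x) ξ ξ‖ := by
          rw [h1, norm_smul, Real.norm_of_nonneg (by linarith)]
      _ ≤ _ := h2
      _ ≤ Γ * ‖ξ‖ ^ (p x - 2) * ‖ξ‖ := by
          gcongr
          exact hgr x hx ξ hξ
      _ = _ := by rw [h3, mul_assoc]
  have h5 : (q - 1) * ‖fluxField p A x ξ‖ ≤ (p x - 1) * ‖fluxField p A x ξ‖ := by gcongr
  rw [div_mul_eq_mul_div, le_div_iff₀ (by linarith)]
  linarith

theorem IsLerayLions.picone (hA : IsLerayLions Ω p A) (hΩ : IsOpen Ω) {q : ℝ}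
    (hq : 1 < q) (hqp : ∀ x ∈ Ω, q < p x) :
    ∀ᵐ x ∂volume.restrict Ω, ∀ (α β : ℝ), 0 < α → 0 < β → ∀ ξ ζ : E N,
      0 ≤ inner ℝ (fluxField p A x ξ) ((1 + (q - 1) * β ^ q * α ^ (-q)) • ξ +
          (-(q * β ^ (q - 1) * α ^ (1 - q))) • ζ) +
        inner ℝ (fluxField p A x ζ) ((1 + (q - 1) * α ^ q * β ^ (-q)) • ζ +
          (-(q * α ^ (q - 1) * β ^ (1 - q))) • ξ) := by
  obtain ⟨γ, hγ, hell⟩ := hA.elliptic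
  filter_upwards [hA.homogeneous, ae_restrict_mem hΩ.measurableSet] with x hhom hx α β hα hβ ξ ζ
  refine DNE.picone hq (hqp x hx) (hA.differentiable x hx) (hA.nonneg x hx) hhom
    (a := fluxField p A x) (fun _ => rfl) (hA.continuous_flux hx) (fun ξ hξ => hA.differentiableAt_flux hΩ hx hξ) ?_ hα hβ ξ ζ
  intro ξ hξ η
  rw [inner_fderiv_flux]
  exact le_trans (by positivity) (hell x hx ξ hξ η)

end LerayLions

/-! ### Functions of one time variable -/

section Time

/-- The chain rule for the square of an absolutely continuous function. -/
theorem integral_mul_const_add_primitive {g : ℝ → ℝ} {t : ℝ} (c : ℝ)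
    (hg : IntervalIntegrable g volume 0 t) :
    ∫ s in (0 : ℝ)..t, g s * (c + ∫ r in (0 : ℝ)..s, g r) =
      ((c + ∫ r in (0 : ℝ)..t, g r) ^ 2 - c ^ 2) / 2 := by
  set G : ℝ → ℝ := fun s => ∫ r in (0 : ℝ)..s, g r with hG
  have hac : AbsolutelyContinuousOnInterval G 0 t :=
    hg.absolutelyContinuousOnInterval_intervalIntegral (by simp)
  have h1 := hac.integral_deriv_mul_eq_sub hac
  have h2 : ∫ s in (0 : ℝ)..t, deriv G s * G s + G s * deriv G s =
      ∫ s in (0 : ℝ)..t, 2 * (g s * G s) := by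
    refine intervalIntegral.integral_congr_ae ?_
    filter_upwards [hg.ae_hasDerivAt_integral] with s hs hs'
    rw [(hs (uIoc_subset_uIcc hs') 0 (by simp)).deriv]
    ring
  have hG0 : G 0 = 0 := by simp [hG]
  have hi : IntervalIntegrable (fun s => g s * G s) volume 0 t := hg.mul_continuousOn hac.continuousOn
  rw [h2, intervalIntegral.integral_const_mul, hG0] at h1
  have h3 : ∫ s in (0 : ℝ)..t, g s * (c + G s) = c * G t + ∫ s in (0 : ℝ)..t, g s * G s := by
    rw [hG, ← intervalIntegral.integral_const_mul, ← intervalIntegral.integral_add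
      (hg.const_mul c) hi]
    refine intervalIntegral.integral_congr fun s _ => ?_
    simp only
    ring
  rw [h3]
  change _ = ((c + G t) ^ 2 - c ^ 2) / 2
  linarith

/-- A Gronwall inequality with a square. At a first time at which `y` reaches the solution
`z = y 0 + δ + ∫ g` of the comparison equation, `y ≤ z` holds in the past, and the integral
inequality for `y` contradicts the identity `z ^ 2 / 2 = z 0 ^ 2 / 2 + ∫ g z`. -/
theorem le_add_integral_of_sq_le {y g : ℝ → ℝ} {T : ℝ} (hy : ContinuousOn y (Icc 0 T))
    (hy0 : ∀ t ∈ Icc 0 T, 0 ≤ y t) (hg : IntervalIntegrable g volume 0 T) (hg0 : ∀ t, 0 ≤ g t)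
    (h : ∀ t ∈ Ioc 0 T, y t ^ 2 ≤ y 0 ^ 2 + 2 * ∫ s in (0 : ℝ)..t, g s * y s)
    {t : ℝ} (ht : t ∈ Icc 0 T) : y t ≤ y 0 + ∫ s in (0 : ℝ)..t, g s := by
  by_contra! hcon
  have h0T : (0 : ℝ) ∈ Icc 0 T := ⟨le_rfl, ht.1.trans ht.2⟩
  have hgs : ∀ s ∈ Icc 0 T, IntervalIntegrable g volume 0 s := fun s hs =>
    hg.mono_set (by rw [uIcc_of_le hs.1, uIcc_of_le h0T.2]; exact Icc_subset_Icc_right hs.2)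
  obtain ⟨δ, hδ, hδt⟩ : ∃ δ > 0, y 0 + δ + ∫ s in (0 : ℝ)..t, g s < y t :=
    ⟨(y t - (y 0 + ∫ s in (0 : ℝ)..t, g s)) / 2, by linarith, by linarith⟩
  set z : ℝ → ℝ := fun s => y 0 + δ + ∫ r in (0 : ℝ)..s, g r with hz
  have hzc : ContinuousOn z (Icc 0 T) := by
    have := hg.absolutelyContinuousOnInterval_intervalIntegral (c := 0) (by simp)
    have := this.continuousOn
    rw [uIcc_of_le h0T.2] at this
    exact continuousOn_const.add this
  have hz0 : ∀ s, 0 ≤ s → y 0 + δ ≤ z s := fun s hs =>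
    le_add_of_nonneg_right (intervalIntegral.integral_nonneg hs fun r _ => hg0 r)
  have hcl : IsClosed {s ∈ Icc 0 T | z s ≤ y s} := isClosed_Icc.isClosed_le hzc hy
  obtain ⟨r, hr, hmin⟩ := (isCompact_Icc.of_isClosed_subset hcl (sep_subset _ _)).exists_isLeast
    ⟨t, ht, hδt.le⟩
  obtain ⟨hrT, hzy⟩ := hr
  have hr0 : 0 < r := by
    refine lt_of_le_of_ne hrT.1 fun h => ?_
    have := hz0 r hrT.1
    rw [← h] at hzy this
    linarith
  have hlt : ∀ s ∈ Ico 0 r, y s < z s := fun s hs => by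
    by_contra! hs'
    exact absurd (hmin ⟨⟨hs.1, hs.2.le.trans hrT.2⟩, hs'⟩) (not_le.2 hs.2)
  have hsub : uIcc 0 r ⊆ Icc 0 T := by
    rw [uIcc_of_le hrT.1]
    exact Icc_subset_Icc_right hrT.2
  have hle : ∫ s in (0 : ℝ)..r, g s * y s ≤ ∫ s in (0 : ℝ)..r, g s * z s := by
    refine intervalIntegral.integral_mono_on_of_le_Ioo hrT.1
      ((hgs r hrT).mul_continuousOn (hy.mono hsub)) ((hgs r hrT).mul_continuousOn (hzc.mono hsub))
      fun s hs => ?_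
    exact mul_le_mul_of_nonneg_left (hlt s ⟨hs.1.le, hs.2⟩).le (hg0 s)
  have hid := integral_mul_const_add_primitive (y 0 + δ) (hgs r hrT)
  have hyr := h r ⟨hr0, hrT.2⟩
  have hy00 := hy0 0 h0T
  have hzr := hz0 r hrT.1
  have : z r ^ 2 ≤ y r ^ 2 := by gcongr; linarith
  change ∫ s in (0 : ℝ)..r, g s * z s = (z r ^ 2 - (y 0 + δ) ^ 2) / 2 at hid
  nlinarith

/-- A smooth compactly supported function on `(0,T)` of integral zero is the derivative of a
function of the same kind. -/
theorem exists_primitive_of_integral_eq_zero {T : ℝ} (hT : 0 < T) {κ : ℝ → ℝ}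
    (hκ : ContDiff ℝ ∞ κ) (hκc : HasCompactSupport κ) (hκs : tsupport κ ⊆ Ioo 0 T)
    (hκ0 : ∫ s, κ s = 0) :
    ∃ θ : ℝ → ℝ, ContDiff ℝ ∞ θ ∧ HasCompactSupport θ ∧ tsupport θ ⊆ Ioo 0 T ∧ deriv θ = κ := by
  obtain ⟨a, b, ha0, hbT, hab⟩ : ∃ a b : ℝ, 0 < a ∧ b < T ∧ tsupport κ ⊆ Ioo a b := by
    have hK : IsCompact (tsupport κ ∪ {T / 2}) := hκc.isCompact.union isCompact_singleton
    have hKs : tsupport κ ∪ {T / 2} ⊆ Ioo 0 T :=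
      union_subset hκs (singleton_subset_iff.2 ⟨by linarith, by linarith⟩)
    obtain ⟨a, ha, ha'⟩ := hK.exists_isLeast ⟨T / 2, by simp⟩
    obtain ⟨b, hb, hb'⟩ := hK.exists_isGreatest ⟨T / 2, by simp⟩
    have h1 := hKs ha
    have h2 := hKs hb
    refine ⟨a / 2, (b + T) / 2, by linarith [h1.1], by linarith [h2.2], fun s hs => ?_⟩
    have h3 := ha' (Or.inl hs)
    have h4 := hb' (Or.inl hs)
    exact ⟨by linarith [h1.1], by linarith [h2.2]⟩
  have hzero : ∀ s, s ∉ Ioo a b → κ s = 0 := fun s hs =>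
    image_eq_zero_of_notMem_tsupport fun h => hs (hab h)
  set θ : ℝ → ℝ := fun s => ∫ r in a..s, κ r with hθ
  have hder : ∀ s, HasDerivAt θ (κ s) s := fun s =>
    (hκ.continuous.integral_hasStrictDerivAt a s).hasDerivAt
  have hderiv : deriv θ = κ := funext fun s => (hder s).deriv
  have hsupp : tsupport θ ⊆ Icc a b := by
    refine closure_minimal (fun s hs => ?_) isClosed_Icc
    by_contra hcon
    refine hs ?_
    rw [mem_Icc, not_and_or, not_le, not_le] at hcon
    rcases hcon with h | h
    · change ∫ r in a..s, κ r = 0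
      rw [intervalIntegral.integral_congr (g := fun _ => (0 : ℝ))]
      · simp
      · intro r hr
        rw [uIcc_of_ge h.le] at hr
        exact hzero r fun h' => absurd h'.1 (not_lt.2 hr.2)
    · change ∫ r in a..s, κ r = 0
      rw [intervalIntegral.integral_eq_integral_of_support_subset, hκ0]
      intro r hr
      have := hab (subset_tsupport κ hr)
      exact ⟨this.1, this.2.le.trans h.le⟩
  refine ⟨θ, ?_, isCompact_Icc.of_isClosed_subset (isClosed_tsupport θ) hsupp,
    hsupp.trans fun s hs => ⟨ha0.trans_le hs.1, hs.2.trans_lt hbT⟩, hderiv⟩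
  rw [contDiff_infty_iff_deriv, hderiv]
  exact ⟨fun s => (hder s).differentiableAt, hκ⟩

/-- The lemma of du Bois-Reymond: a continuous function with vanishing weak derivative is
constant. -/
theorem eq_of_integral_mul_deriv_eq_zero {D : ℝ → ℝ} {T : ℝ} (hT : 0 < T)
    (hD : ContinuousOn D (Icc 0 T))
    (h : ∀ θ : ℝ → ℝ, ContDiff ℝ ∞ θ → HasCompactSupport θ → tsupport θ ⊆ Ioo 0 T →
      ∫ s in Ioo 0 T, D s * deriv θ s = 0) {t : ℝ} (ht : t ∈ Icc 0 T) : D t = D 0 := by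
  let bump : ContDiffBump (T / 2) := ⟨T / 8, T / 4, by linarith, by linarith⟩
  set χ₀ : ℝ → ℝ := bump.normed volume with hχ₀
  have hχ₀s : tsupport χ₀ ⊆ Ioo 0 T := by
    rw [hχ₀, bump.tsupport_normed_eq, Real.closedBall_eq_Icc]
    intro s hs
    have hr : bump.rOut = T / 4 := rfl
    rw [hr] at hs
    exact ⟨by linarith [hs.1], by linarith [hs.2]⟩
  have hχ₀c : Continuous χ₀ := bump.continuous_normed
  have hDi : IntegrableOn D (Ioo 0 T) :=
    (hD.integrableOn_compact isCompact_Icc).mono_set Ioo_subset_Icc_self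
  have hmul : ∀ χ : ℝ → ℝ, Continuous χ → HasCompactSupport χ →
      IntegrableOn (fun s => D s * χ s) (Ioo 0 T) := fun χ hχ hχc => by
    obtain ⟨C, hC⟩ := hχ.bounded_above_of_compact_support hχc
    exact hDi.mul_bdd (c := C) hχ.aestronglyMeasurable (Eventually.of_forall hC)
  set k : ℝ := ∫ s in Ioo 0 T, D s * χ₀ s with hk
  have hae : ∀ᵐ s, s ∈ Ioo 0 T → D s - k = 0 := by
    refine isOpen_Ioo.ae_eq_zero_of_integral_contDiff_smul_eq_zero
      ((hDi.sub (integrable_const k)).locallyIntegrableOn) fun χ hχ hχc hχs => ?_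
    set c : ℝ := ∫ s, χ s with hc
    have hi : Integrable χ := hχ.continuous.integrable_of_hasCompactSupport hχc
    have hi₀ : Integrable χ₀ :=
      hχ₀c.integrable_of_hasCompactSupport bump.hasCompactSupport_normed
    obtain ⟨θ, h1, h2, h3, h4⟩ := exists_primitive_of_integral_eq_zero hT
      (κ := fun s => χ s - c * χ₀ s)
      (hχ.sub (contDiff_const.mul bump.contDiff_normed))
      (hχc.sub bump.hasCompactSupport_normed.mul_left)
      ((tsupport_sub _ _).trans (union_subset hχs
        ((closure_mono (Function.support_mul_subset_right _ _)).trans hχ₀s)))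
      (by
        rw [integral_sub hi (hi₀.const_mul c), integral_const_mul, bump.integral_normed]
        simp [hc])
    have h5 := h θ h1 h2 h3
    have h6 : ∀ s, D s * deriv θ s = D s * χ s - c * (D s * χ₀ s) := fun s => by
      rw [h4]
      ring
    simp only [h6] at h5
    rw [integral_sub (hmul χ hχ.continuous hχc) ((hmul χ₀ hχ₀c
      bump.hasCompactSupport_normed).const_mul c), integral_const_mul] at h5
    have h7 : ∫ s, χ s • (D s - k) = ∫ s in Ioo 0 T, χ s • (D s - k) := by
      rw [setIntegral_eq_integral_of_forall_compl_eq_zero]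
      intro s hs
      rw [image_eq_zero_of_notMem_tsupport fun h => hs (hχs h), zero_smul]
    have h8 : c = ∫ s in Ioo 0 T, χ s := by
      rw [setIntegral_eq_integral_of_forall_compl_eq_zero]
      intro s hs
      exact image_eq_zero_of_notMem_tsupport fun h => hs (hχs h)
    have h9 : ∀ s, χ s • (D s - k) = D s * χ s - k * χ s := fun s => by
      rw [smul_eq_mul]
      ring
    rw [h7]
    simp only [h9]
    rw [integral_sub (hmul χ hχ.continuous hχc) (hi.integrableOn.const_mul k), integral_const_mul,
      ← h8, mul_comm k c]
    exact h5
  have hIoo : EqOn D (fun _ => k) (Ioo 0 T) := by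
    refine Measure.eqOn_open_of_ae_eq (μ := volume) ?_ isOpen_Ioo (hD.mono Ioo_subset_Icc_self)
      continuousOn_const
    rw [EventuallyEq, ae_restrict_iff' measurableSet_Ioo]
    filter_upwards [hae] with s hs hs' using by linarith [hs hs']
  have hIcc : EqOn D (fun _ => k) (Icc 0 T) := by
    rw [← closure_Ioo hT.ne] at hD ⊢
    exact hIoo.of_subset_closure hD continuousOn_const subset_closure subset_rfl
  rw [hIcc ht, hIcc ⟨le_rfl, hT.le⟩]

/-- A continuous function with an integrable weak derivative is the primitive of the latter. -/
theorem eq_add_integral_of_weak_deriv {u g : ℝ → ℝ} {T : ℝ} (hT : 0 < T)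
    (hu : ContinuousOn u (Icc 0 T)) (hg : IntegrableOn g (Ioo 0 T))
    (h : ∀ θ : ℝ → ℝ, ContDiff ℝ ∞ θ → HasCompactSupport θ → tsupport θ ⊆ Ioo 0 T →
      ∫ s in Ioo 0 T, u s * deriv θ s = -∫ s in Ioo 0 T, g s * θ s) {t : ℝ} (ht : t ∈ Icc 0 T) :
    u t = u 0 + ∫ s in (0 : ℝ)..t, g s := by
  have hgI : IntervalIntegrable g volume 0 T := by
    rwa [intervalIntegrable_iff_integrableOn_Ioo_of_le hT.le]
  have hac : AbsolutelyContinuousOnInterval (fun s => ∫ r in (0 : ℝ)..s, g r) 0 T :=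
    hgI.absolutelyContinuousOnInterval_intervalIntegral (by simp)
  have hGc : ContinuousOn (fun s => ∫ r in (0 : ℝ)..s, g r) (Icc 0 T) := by
    have := hac.continuousOn
    rwa [uIcc_of_le hT.le] at this
  have key := eq_of_integral_mul_deriv_eq_zero (D := fun s => u s - ∫ r in (0 : ℝ)..s, g r) hT
    (hu.sub hGc) ?_ ht
  · simp only [intervalIntegral.integral_same, sub_zero] at key
    linarith
  intro θ h1 h2 h3
  have hθ0 : θ 0 = 0 := image_eq_zero_of_notMem_tsupport fun h => (lt_irrefl _ (h3 h).1)
  have hθT : θ T = 0 := image_eq_zero_of_notMem_tsupport fun h => (lt_irrefl _ (h3 h).2)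
  have hθac : AbsolutelyContinuousOnInterval θ 0 T :=
    (h1.of_le (by simp) : ContDiff ℝ 1 θ).contDiffOn.absolutelyContinuousOnInterval
  have h4 := hac.integral_mul_deriv_eq_deriv_mul hθac
  have h5 : ∫ s in (0 : ℝ)..T, deriv (fun s => ∫ r in (0 : ℝ)..s, g r) s * θ s =
      ∫ s in (0 : ℝ)..T, g s * θ s := by
    refine intervalIntegral.integral_congr_ae ?_
    filter_upwards [hgI.ae_hasDerivAt_integral] with s hs hs'
    rw [(hs (uIoc_subset_uIcc hs') 0 (by simp)).deriv]
  rw [h5, hθ0, hθT] at h4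
  simp only [mul_zero, sub_zero, zero_sub] at h4
  rw [intervalIntegral.integral_of_le hT.le, intervalIntegral.integral_of_le hT.le,
    integral_Ioc_eq_integral_Ioo, integral_Ioc_eq_integral_Ioo] at h4
  have hd : Continuous (deriv θ) := h1.continuous_deriv (by simp)
  obtain ⟨C, hC⟩ := hd.bounded_above_of_compact_support h2.deriv
  have hmul : ∀ f : ℝ → ℝ, ContinuousOn f (Icc 0 T) →
      IntegrableOn (fun s => f s * deriv θ s) (Ioo 0 T) := fun f hf =>
    ((hf.integrableOn_compact isCompact_Icc).mono_set Ioo_subset_Icc_self).mul_bdd (c := C)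
      hd.aestronglyMeasurable (Eventually.of_forall hC)
  simp only [sub_mul]
  rw [integral_sub (hmul u hu) (hmul _ hGc), h θ h1 h2 h3, h4, sub_self]

end Time

/-! ### The energy identity on the cylinder -/

section Energy

theorem ae_eq_prod_of_ae_ae_eq {α β : Type*} [MeasurableSpace α] [MeasurableSpace β]
    {μ : Measure α} {ν : Measure β} [SFinite μ] [SFinite ν] {f g : α × β → ℝ}
    (hf : AEStronglyMeasurable f (μ.prod ν)) (hg : AEStronglyMeasurable g (μ.prod ν))
    (h : ∀ᵐ s ∂μ, ∀ᵐ x ∂ν, f (s, x) = g (s, x)) : f =ᵐ[μ.prod ν] g := by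
  have h1 : ∀ᵐ z ∂μ.prod ν, hf.mk f z = hg.mk g z := by
    rw [Measure.ae_prod_iff_ae_ae
      (hf.stronglyMeasurable_mk.measurableSet_eq_fun hg.stronglyMeasurable_mk)]
    filter_upwards [h, Measure.ae_ae_of_ae_prod hf.ae_eq_mk, Measure.ae_ae_of_ae_prod hg.ae_eq_mk]
      with s h1 h2 h3
    filter_upwards [h1, h2, h3] with x h1 h2 h3
    rw [← h2, ← h3, h1]
  filter_upwards [h1, hf.ae_eq_mk, hg.ae_eq_mk] with z h1 h2 h3
  rw [h2, h3, h1]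

theorem sq_toReal_eLpNorm_two {α : Type*} [MeasurableSpace α] {μ : Measure α} {f : α → ℝ}
    (hf : MemLp f 2 μ) : (eLpNorm f 2 μ).toReal ^ 2 = ∫ x, f x ^ 2 ∂μ := by
  rw [hf.eLpNorm_eq_integral_rpow_norm (by simp) (by simp)]
  have h0 : 0 ≤ ∫ x, ‖f x‖ ^ (2 : ℝ≥0∞).toReal ∂μ := integral_nonneg fun x => by positivity
  rw [ENNReal.toReal_ofReal (by positivity), ← Real.rpow_natCast, ← Real.rpow_mul h0]
  simp

variable {N : ℕ} {Ω : Set (E N)} {T : ℝ}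

theorem cylMeasure_mono {t : ℝ} (ht : t ≤ T) : cylMeasure t Ω ≤ cylMeasure T Ω := by
  rw [cylMeasure, cylMeasure, Measure.prod_restrict, Measure.prod_restrict]
  exact Measure.restrict_mono (prod_mono (Ioo_subset_Ioo_right ht) subset_rfl) le_rfl

theorem isFiniteMeasure_cylMeasure (hΩ : volume Ω ≠ ⊤) : IsFiniteMeasure (cylMeasure T Ω) := by
  have : IsFiniteMeasure (volume.restrict Ω) := isFiniteMeasure_restrict.2 hΩ
  unfold cylMeasure
  infer_instance

theorem IsContinuousL2.continuousOn_integral_mul {U : ℝ → E N → ℝ} {η : E N → ℝ} {C : ℝ}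
    (hΩ : volume Ω ≠ ⊤) (hU : IsContinuousL2 T Ω U) (hη : Continuous η) (hC : ∀ x, ‖η x‖ ≤ C) :
    ContinuousOn (fun t => ∫ x in Ω, U t x * η x) (Icc 0 T) := by
  have : IsFiniteMeasure (volume.restrict Ω) := isFiniteMeasure_restrict.2 hΩ
  intro t ht
  have hint : ∀ s ∈ Icc 0 T, Integrable (fun x => U s x * η x) (volume.restrict Ω) := fun s hs =>
    ((hU s hs).1.integrable (by simp)).mul_bdd (c := C) hη.aestronglyMeasurable
      (Eventually.of_forall hC)
  refine tendsto_integral_of_L1 _ (hint t ht).aestronglyMeasurable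
    (eventually_nhdsWithin_of_forall hint) ?_
  set k : ℝ≥0∞ := volume.restrict Ω univ ^
    (1 / (1 : ℝ≥0∞).toReal - 1 / (2 : ℝ≥0∞).toReal) with hk
  have hkt : k ≠ ⊤ := ENNReal.rpow_ne_top_of_nonneg (by norm_num) (measure_ne_top _ _)
  have h1 : Tendsto (fun s => ENNReal.ofReal C *
      (eLpNorm (fun x => U s x - U t x) 2 (volume.restrict Ω) * k)) (𝓝[Icc 0 T] t) (𝓝 0) := by
    have := ENNReal.Tendsto.const_mul (a := ENNReal.ofReal C)
      (ENNReal.Tendsto.mul_const (b := k) (hU t ht).2 (Or.inr hkt)) (Or.inr ENNReal.ofReal_ne_top)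
    simpa using this
  refine tendsto_of_tendsto_of_tendsto_of_le_of_le' tendsto_const_nhds h1
    (Eventually.of_forall fun _ => zero_le) (eventually_nhdsWithin_of_forall fun s hs => ?_)
  refine le_trans ?_ (mul_le_mul_right (eLpNorm_le_eLpNorm_mul_rpow_measure_univ
    (by norm_num : (1 : ℝ≥0∞) ≤ 2) ((hU s hs).1.1.sub (hU t ht).1.1)) _)
  rw [eLpNorm_one_eq_lintegral_enorm, ← lintegral_const_mul' _ _ ENNReal.ofReal_ne_top]
  refine lintegral_mono fun x => ?_
  rw [← sub_mul, enorm_mul, mul_comm, ← ofReal_norm (η x)]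
  gcongr
  · exact hC x
  · rfl

theorem IsContinuousL2.continuousOn_norm {U : ℝ → E N → ℝ} (hU : IsContinuousL2 T Ω U) :
    ContinuousOn (fun t => (eLpNorm (U t) 2 (volume.restrict Ω)).toReal) (Icc 0 T) := by
  intro t ht
  have h0 : Tendsto (fun s => (eLpNorm (fun x => U s x - U t x) 2 (volume.restrict Ω)).toReal)
      (𝓝[Icc 0 T] t) (𝓝 0) := by
    exact (ENNReal.continuousAt_toReal ENNReal.zero_ne_top).tendsto.comp (hU t ht).2
  refine tendsto_iff_norm_sub_tendsto_zero.2 ?_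
  refine tendsto_of_tendsto_of_tendsto_of_le_of_le' tendsto_const_nhds h0
    (Eventually.of_forall fun _ => norm_nonneg _) (eventually_nhdsWithin_of_forall fun s hs => ?_)
  have hs' := (hU s hs).1
  have ht' := (hU t ht).1
  have hd : MemLp (fun x => U s x - U t x) 2 (volume.restrict Ω) := hs'.sub ht'
  have e1 : eLpNorm (U s) 2 (volume.restrict Ω) ≤
      eLpNorm (fun x => U s x - U t x) 2 (volume.restrict Ω) +
        eLpNorm (U t) 2 (volume.restrict Ω) := by
    refine le_trans (le_of_eq ?_) (eLpNorm_add_le hd.1 ht'.1 (by norm_num))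
    congr 1
    ext x
    simp
  have e2 : eLpNorm (U t) 2 (volume.restrict Ω) ≤
      eLpNorm (fun x => U s x - U t x) 2 (volume.restrict Ω) +
        eLpNorm (U s) 2 (volume.restrict Ω) := by
    have hd' : eLpNorm (fun x => U s x - U t x) 2 (volume.restrict Ω) =
        eLpNorm (fun x => U t x - U s x) 2 (volume.restrict Ω) :=
      eLpNorm_sub_comm (U s) (U t) 2 _
    rw [hd']
    refine le_trans (le_of_eq ?_) (eLpNorm_add_le (ht'.1.sub hs'.1) hs'.1 (by norm_num))
    congr 1
    ext x
    simp
  have e1' := ENNReal.toReal_mono (ENNReal.add_ne_top.2 ⟨hd.2.ne, ht'.2.ne⟩) e1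
  have e2' := ENNReal.toReal_mono (ENNReal.add_ne_top.2 ⟨hd.2.ne, hs'.2.ne⟩) e2
  rw [ENNReal.toReal_add hd.2.ne ht'.2.ne] at e1'
  rw [ENNReal.toReal_add hd.2.ne hs'.2.ne] at e2'
  rw [Real.norm_eq_abs, abs_le]
  constructor <;> linarith

variable {U U' : ℝ → E N → ℝ}

/-- The weak time derivative tested with products `θ(t) η(x)`. -/
theorem integral_mul_eq_of_isWeakTimeDeriv (hT : 0 < T) (hΩv : volume Ω ≠ ⊤)
    (hUc : IsContinuousL2 T Ω U)
    (hU : Integrable (fun z : ℝ × E N => U z.1 z.2) (cylMeasure T Ω))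
    (hU' : Integrable (fun z : ℝ × E N => U' z.1 z.2) (cylMeasure T Ω))
    (hw : IsWeakTimeDeriv T Ω U U') {η : E N → ℝ} (hη : IsTestFunction Ω η) {t : ℝ}
    (ht : t ∈ Icc 0 T) :
    ∫ x in Ω, U t x * η x = (∫ x in Ω, U 0 x * η x) + ∫ s in (0 : ℝ)..t, ∫ x in Ω, U' s x * η x := by
  obtain ⟨C, hC⟩ := hη.1.continuous.bounded_above_of_compact_support hη.2.1
  have hmul : ∀ {V : ℝ × E N → ℝ} {θ : ℝ → ℝ}, Integrable V (cylMeasure T Ω) → Continuous θ →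
      HasCompactSupport θ → Integrable (fun z => V z * (θ z.1 * η z.2)) (cylMeasure T Ω) := by
    intro V θ hV hθ hθc
    obtain ⟨C', hC'⟩ := hθ.bounded_above_of_compact_support hθc
    refine hV.mul_bdd (c := C' * C) ?_ (Eventually.of_forall fun z => ?_)
    · exact ((hθ.comp continuous_fst).mul (hη.1.continuous.comp continuous_snd)).aestronglyMeasurable
    · rw [norm_mul]
      exact mul_le_mul (hC' _) (hC _) (norm_nonneg _) ((norm_nonneg _).trans (hC' z.1))
  have hg : Integrable (fun z : ℝ × E N => U' z.1 z.2 * η z.2) (cylMeasure T Ω) :=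
    hU'.mul_bdd (c := C) (hη.1.continuous.comp continuous_snd).aestronglyMeasurable
      (Eventually.of_forall fun z => hC z.2)
  refine eq_add_integral_of_weak_deriv (u := fun t => ∫ x in Ω, U t x * η x) hT
    (hUc.continuousOn_integral_mul hΩv hη.1.continuous hC) hg.integral_prod_left ?_ ht
  intro θ h1 h2 h3
  have hsub : tsupport (fun z : ℝ × E N => θ z.1 * η z.2) ⊆ tsupport θ ×ˢ tsupport η := by
    refine closure_minimal (fun z hz => ?_) ((isClosed_tsupport θ).prod (isClosed_tsupport η))
    exact ⟨subset_tsupport _ (left_ne_zero_of_mul hz), subset_tsupport _ (right_ne_zero_of_mul hz)⟩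
  have h := hw (fun z => θ z.1 * η z.2)
    ((h1.comp contDiff_fst).mul (hη.1.comp contDiff_snd))
    ((h2.isCompact.prod hη.2.1.isCompact).of_isClosed_subset (isClosed_tsupport _) hsub)
    (hsub.trans (prod_mono h3 hη.2.2))
  have hd : ∀ z : ℝ × E N, deriv (fun s => θ s * η z.2) z.1 = deriv θ z.1 * η z.2 := fun z =>
    deriv_mul_const (h1.differentiable (by simp) z.1) _
  simp only [hd] at h
  have i1 := hmul hU (h1.continuous_deriv (by simp)) h2.deriv
  have i2 := hmul hU' h1.continuous h2
  rw [cylMeasure] at h i1 i2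
  rw [integral_prod _ i1, integral_prod _ i2] at h
  have r1 : ∀ (V : ℝ → E N → ℝ) (s c : ℝ), ∫ x in Ω, V s x * (c * η x) =
      (∫ x in Ω, V s x * η x) * c := fun V s c => by
    rw [← integral_mul_const]
    refine integral_congr_ae (Eventually.of_forall fun x => ?_)
    simp only
    ring
  simp only [r1] at h
  exact h

/-- A function in `C([0,T]; L²)` is, for almost every `x`, the primitive in time of its weak time
derivative. -/
theorem ae_eq_add_integral_of_isWeakTimeDeriv (hT : 0 < T) (hΩ : IsOpen Ω) (hΩv : volume Ω ≠ ⊤)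
    (hUc : IsContinuousL2 T Ω U)
    (hU : Integrable (fun z : ℝ × E N => U z.1 z.2) (cylMeasure T Ω))
    (hU' : Integrable (fun z : ℝ × E N => U' z.1 z.2) (cylMeasure T Ω))
    (hw : IsWeakTimeDeriv T Ω U U') {t : ℝ} (ht : t ∈ Icc 0 T) :
    ∀ᵐ x ∂volume.restrict Ω, U t x = U 0 x + ∫ s in (0 : ℝ)..t, U' s x := by
  have : IsFiniteMeasure (volume.restrict Ω) := isFiniteMeasure_restrict.2 hΩv
  have hU't := hU'.mono_measure (cylMeasure_mono (Ω := Ω) ht.2)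
  have hconv : ∀ f : ℝ → ℝ, ∫ s in (0 : ℝ)..t, f s = ∫ s in Ioo 0 t, f s := fun f => by
    rw [intervalIntegral.integral_of_le ht.1, integral_Ioc_eq_integral_Ioo]
  have hprim : Integrable (fun x => ∫ s in (0 : ℝ)..t, U' s x) (volume.restrict Ω) := by
    simp only [hconv]
    exact hU't.integral_prod_right
  have i1 := (hUc t ht).1.integrable (by simp)
  have i0 := (hUc 0 ⟨le_rfl, hT.le⟩).1.integrable (by simp)
  have hR : Integrable (fun x => U t x - U 0 x - ∫ s in (0 : ℝ)..t, U' s x)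
      (volume.restrict Ω) := (i1.sub i0).sub hprim
  have hae := hΩ.ae_eq_zero_of_integral_contDiff_smul_eq_zero
    (IntegrableOn.locallyIntegrableOn hR) ?_
  · rw [ae_restrict_iff' hΩ.measurableSet]
    filter_upwards [hae] with x hx hx'
    linarith [hx hx']
  intro η h1 h2 h3
  obtain ⟨C, hC⟩ := h1.continuous.bounded_above_of_compact_support h2
  have hb : ∀ {f : E N → ℝ}, Integrable f (volume.restrict Ω) →
      Integrable (fun x => f x * η x) (volume.restrict Ω) := fun hf =>
    hf.mul_bdd (c := C) h1.continuous.aestronglyMeasurable (Eventually.of_forall hC)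
  have key := integral_mul_eq_of_isWeakTimeDeriv hT hΩv hUc hU hU' hw ⟨h1, h2, h3⟩ ht
  have hswap : ∫ s in (0 : ℝ)..t, ∫ x in Ω, U' s x * η x =
      ∫ x in Ω, (∫ s in (0 : ℝ)..t, U' s x) * η x := by
    simp only [hconv]
    rw [integral_integral_swap]
    · simp only [integral_mul_const]
    · exact hU't.mul_bdd (c := C) (h1.continuous.comp continuous_snd).aestronglyMeasurable
        (Eventually.of_forall fun z => hC z.2)
  rw [hswap] at key
  have e : ∀ x, η x • (U t x - U 0 x - ∫ s in (0 : ℝ)..t, U' s x) =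
      U t x * η x - U 0 x * η x - (∫ s in (0 : ℝ)..t, U' s x) * η x := fun x => by
    rw [smul_eq_mul]
    ring
  rw [← setIntegral_eq_integral_of_forall_compl_eq_zero (s := Ω)]
  · simp only [e]
    rw [integral_sub, integral_sub (hb i1) (hb i0), key]
    · ring
    · exact (hb i1).sub (hb i0)
    · exact hb hprim
  · intro x hx
    rw [image_eq_zero_of_notMem_tsupport fun h => hx (h3 h), zero_smul]

theorem stronglyMeasurable_primitive (hU'm : StronglyMeasurable fun z : ℝ × E N => U' z.1 z.2) :
    StronglyMeasurable fun z : ℝ × E N => ∫ s in Ioc 0 z.1, U' s z.2 := by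
  have h : StronglyMeasurable fun w : (ℝ × E N) × ℝ =>
      ({w | 0 < w.2 ∧ w.2 ≤ w.1.1} : Set ((ℝ × E N) × ℝ)).indicator
        (fun w => U' w.2 w.1.2) w := by
    refine StronglyMeasurable.indicator ?_ ?_
    · exact hU'm.comp_measurable (g := fun w : (ℝ × E N) × ℝ => (w.2, w.1.2)) (by fun_prop)
    · exact (measurableSet_lt measurable_const measurable_snd).inter
        (measurableSet_le measurable_snd (measurable_fst.comp measurable_fst))
  have h' := h.integral_prod_right' (ν := volume)
  refine (congrArg StronglyMeasurable (funext fun z => ?_)).mp h'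
  rw [← integral_indicator measurableSet_Ioc]
  rfl

/-- The energy identity `‖U(t)‖² = ‖U(0)‖² + 2 ∫_0^t ∫_Ω U' U`. For almost every `x` the function
`U(·, x)` may be replaced by the primitive of `U'(·, x)`, for which the identity holds pointwise
in `x`. -/
theorem energy_identity (hT : 0 < T) (hΩ : IsOpen Ω) (hΩv : volume Ω ≠ ⊤)
    (hUc : IsContinuousL2 T Ω U)
    (hU : MemLp (fun z : ℝ × E N => U z.1 z.2) 2 (cylMeasure T Ω))
    (hU' : MemLp (fun z : ℝ × E N => U' z.1 z.2) 2 (cylMeasure T Ω))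
    (hw : IsWeakTimeDeriv T Ω U U') {t : ℝ} (ht : t ∈ Icc 0 T) :
    ∫ x in Ω, U t x ^ 2 = (∫ x in Ω, U 0 x ^ 2) +
      2 * ∫ z, U' z.1 z.2 * U z.1 z.2 ∂cylMeasure t Ω := by
  wlog hm : StronglyMeasurable fun z : ℝ × E N => U' z.1 z.2 generalizing U'
  · have hae := hU'.1.ae_eq_mk
    have h := this (U' := fun s x => hU'.1.mk _ (s, x)) (hU'.ae_eq hae) ?_
      hU'.1.stronglyMeasurable_mk
    · rw [h]
      congr 2
      refine integral_congr_ae ?_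
      filter_upwards [ae_mono (cylMeasure_mono ht.2) hae] with z hz
      rw [hz]
    · intro ψ h1 h2 h3
      rw [hw ψ h1 h2 h3]
      congr 1
      refine integral_congr_ae ?_
      filter_upwards [hae] with z hz
      rw [hz]
  have hfin : IsFiniteMeasure (volume.restrict Ω) := isFiniteMeasure_restrict.2 hΩv
  have hfin' := isFiniteMeasure_cylMeasure (T := T) hΩv
  have hUi := hU.integrable (by simp)
  have hU'i := hU'.integrable (by simp)
  have hrep : ∀ s ∈ Icc 0 T, ∀ᵐ x ∂volume.restrict Ω, U s x = U 0 x + ∫ r in (0 : ℝ)..s, U' r x :=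
    fun s hs => ae_eq_add_integral_of_isWeakTimeDeriv hT hΩ hΩv hUc hUi hU'i hw hs
  have h00 : (0 : ℝ) ∈ Icc 0 T := ⟨le_rfl, hT.le⟩
  have hmono := cylMeasure_mono (Ω := Ω) ht.2
  -- The representation holds almost everywhere on the cylinder.
  have hWU : (fun z : ℝ × E N => U z.1 z.2) =ᵐ[cylMeasure t Ω]
      fun z => U 0 z.2 + ∫ r in (0 : ℝ)..z.1, U' r z.2 := by
    have hW : (fun z : ℝ × E N => U 0 z.2 + ∫ r in Ioc 0 z.1, U' r z.2) =ᵐ[cylMeasure t Ω]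
        fun z => U 0 z.2 + ∫ r in (0 : ℝ)..z.1, U' r z.2 := by
      have : ∀ᵐ z ∂cylMeasure t Ω, z.1 ∈ Ioo 0 t :=
        Measure.quasiMeasurePreserving_fst.ae (ae_restrict_mem measurableSet_Ioo)
      filter_upwards [this] with z hz
      rw [intervalIntegral.integral_of_le hz.1.le]
    refine EventuallyEq.trans ?_ hW
    refine ae_eq_prod_of_ae_ae_eq (hU.1.mono_measure hmono) ?_ ?_
    · exact ((hUc 0 h00).1.1.comp_snd).add (stronglyMeasurable_primitive hm).aestronglyMeasurable
    · filter_upwards [ae_restrict_mem measurableSet_Ioo] with s hs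
      filter_upwards [hrep s ⟨hs.1.le, hs.2.le.trans ht.2⟩] with x hx
      rw [hx, intervalIntegral.integral_of_le hs.1.le]
  have hprod : Integrable (fun z : ℝ × E N => U' z.1 z.2 *
      (U 0 z.2 + ∫ r in (0 : ℝ)..z.1, U' r z.2)) (cylMeasure t Ω) := by
    refine ((hU'.mono_measure hmono).integrable_mul (hU.mono_measure hmono)).congr ?_
    filter_upwards [hWU] with z hz
    rw [Pi.mul_apply, hz]
  have h1 : ∫ z, U' z.1 z.2 * U z.1 z.2 ∂cylMeasure t Ω =
      ∫ z, U' z.1 z.2 * (U 0 z.2 + ∫ r in (0 : ℝ)..z.1, U' r z.2) ∂cylMeasure t Ω := by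
    refine integral_congr_ae ?_
    filter_upwards [hWU] with z hz
    rw [hz]
  have h2 : ∫ z, U' z.1 z.2 * (U 0 z.2 + ∫ r in (0 : ℝ)..z.1, U' r z.2) ∂cylMeasure t Ω =
      ∫ x in Ω, (U t x ^ 2 - U 0 x ^ 2) / 2 := by
    rw [cylMeasure] at hprod ⊢
    rw [integral_prod_symm _ hprod]
    refine integral_congr_ae ?_
    have hsec := (hU'i.mono_measure hmono).prod_left_ae
    filter_upwards [hsec, hrep t ht] with x hx hx'
    have hI : IntervalIntegrable (fun s => U' s x) volume 0 t := by
      rwa [intervalIntegrable_iff_integrableOn_Ioo_of_le ht.1]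
    have := integral_mul_const_add_primitive (U 0 x) hI
    rw [intervalIntegral.integral_of_le ht.1, integral_Ioc_eq_integral_Ioo, ← hx'] at this
    exact this
  rw [h1, h2, integral_div, integral_sub (hUc t ht).1.integrable_sq (hUc 0 h00).1.integrable_sq]
  ring

end Energy

/-! ### The test functions -/

section TestFunctions

/-- The function `((a + ε) ^ q - (b + ε) ^ q) / (a + ε) ^ (q - 1)` of `z = (a, b)`. -/
noncomputable def diazSaa (q ε : ℝ) (z : ℝ × ℝ) : ℝ :=
  (z.1 + ε) - (z.2 + ε) ^ q * (z.1 + ε) ^ (1 - q)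

theorem contDiffAt_diazSaa {q ε : ℝ} {z : ℝ × ℝ} (h1 : 0 < z.1 + ε) (h2 : 0 < z.2 + ε) :
    ContDiffAt ℝ ∞ (diazSaa q ε) z := by
  have c1 : ContDiffAt ℝ ∞ (fun z : ℝ × ℝ => z.1 + ε) z := contDiffAt_fst.add contDiffAt_const
  have c2 : ContDiffAt ℝ ∞ (fun z : ℝ × ℝ => z.2 + ε) z := contDiffAt_snd.add contDiffAt_const
  exact c1.sub ((c2.rpow_const_of_ne h2.ne').mul (c1.rpow_const_of_ne h1.ne'))

theorem fderiv_diazSaa {q ε a b : ℝ} (h1 : 0 < a + ε) (h2 : 0 < b + ε) :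
    fderiv ℝ (diazSaa q ε) (a, b) (1, 0) = 1 + (q - 1) * (b + ε) ^ q * (a + ε) ^ (-q) ∧
      fderiv ℝ (diazSaa q ε) (a, b) (0, 1) = -(q * (b + ε) ^ (q - 1) * (a + ε) ^ (1 - q)) := by
  have hd : HasFDerivAt (diazSaa q ε) (fderiv ℝ (diazSaa q ε) (a, b)) (a, b) :=
    ((contDiffAt_diazSaa h1 h2).differentiableAt (by simp)).hasFDerivAt
  constructor
  · have l := hd.comp_hasDerivAt_of_eq a ((hasDerivAt_id a).prodMk (hasDerivAt_const a b)) rfl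
    have r : HasDerivAt (fun s : ℝ => (s + ε) - (b + ε) ^ q * (s + ε) ^ (1 - q))
        (1 - (b + ε) ^ q * (1 * (1 - q) * (a + ε) ^ (1 - q - 1))) a :=
      ((hasDerivAt_id a).add_const ε).sub
        ((((hasDerivAt_id a).add_const ε).rpow_const (Or.inl h1.ne')).const_mul _)
    have e : 1 - q - 1 = -q := by ring
    rw [e] at r
    rw [l.unique r]
    ring
  · have l := hd.comp_hasDerivAt_of_eq b ((hasDerivAt_const b a).prodMk (hasDerivAt_id b)) rfl
    have r : HasDerivAt (fun s : ℝ => (a + ε) - (s + ε) ^ q * (a + ε) ^ (1 - q))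
        (-(1 * q * (b + ε) ^ (q - 1) * (a + ε) ^ (1 - q))) b :=
      ((((hasDerivAt_id b).add_const ε).rpow_const (Or.inl h2.ne')).mul_const _).const_sub _
    rw [l.unique r]
    ring

/-- A smooth compactly supported function on the plane that coincides with `diazSaa` on the square
`(0,M)²`. It is the product of `diazSaa` with a cutoff that is supported where `diazSaa` is
smooth. -/
theorem exists_cutoff_diazSaa {q ε M : ℝ} (hε : 0 < ε) (hM : 0 < M) :
    ∃ Φ : ℝ × ℝ → ℝ, ContDiff ℝ ∞ Φ ∧ Φ 0 = 0 ∧ (∃ L > 0, ∀ z, ‖fderiv ℝ Φ z‖ ≤ L) ∧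
      (∃ C, ∀ z, ‖Φ z‖ ≤ C) ∧ EqOn Φ (diazSaa q ε) (Ioo 0 M ×ˢ Ioo 0 M) := by
  let χ : ContDiffBump (M / 2) := ⟨M / 2, M / 2 + ε / 2, by positivity, by linarith⟩
  have hrOut : χ.rOut = M / 2 + ε / 2 := rfl
  have hrIn : χ.rIn = M / 2 := rfl
  have hχ1 : ∀ s ∈ Icc 0 M, χ s = 1 := fun s hs => by
    refine χ.one_of_mem_closedBall ?_
    rw [Real.closedBall_eq_Icc, hrIn]
    exact ⟨by linarith [hs.1], by linarith [hs.2]⟩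
  have hχs : ∀ s ∈ tsupport χ, 0 < s + ε := fun s hs => by
    rw [χ.tsupport_eq, Real.closedBall_eq_Icc, hrOut] at hs
    linarith [hs.1]
  set Φ : ℝ × ℝ → ℝ := fun z => χ z.1 * χ z.2 * diazSaa q ε z with hΦ
  have hK : IsClosed (tsupport χ ×ˢ tsupport χ) := (isClosed_tsupport _).prod (isClosed_tsupport _)
  have hzero : ∀ z, z ∉ tsupport χ ×ˢ tsupport χ → Φ z = 0 := fun z hz => by
    rw [mem_prod, not_and_or] at hz
    rcases hz with h | h
    · simp [hΦ, image_eq_zero_of_notMem_tsupport h]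
    · simp [hΦ, image_eq_zero_of_notMem_tsupport h]
  have hsm : ContDiff ℝ ∞ Φ := by
    refine contDiff_iff_contDiffAt.2 fun z => ?_
    by_cases hz : z ∈ tsupport χ ×ˢ tsupport χ
    · exact ((χ.contDiff.contDiffAt.comp z contDiffAt_fst).mul
        (χ.contDiff.contDiffAt.comp z contDiffAt_snd)).mul
        (contDiffAt_diazSaa (hχs _ hz.1) (hχs _ hz.2))
    · refine (contDiffAt_const (c := (0 : ℝ))).congr_of_eventuallyEq ?_
      filter_upwards [hK.isOpen_compl.mem_nhds hz] with y hy using hzero y hy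
  have hcs : HasCompactSupport Φ := by
    refine (χ.hasCompactSupport.isCompact.prod χ.hasCompactSupport.isCompact).of_isClosed_subset
      (isClosed_tsupport Φ) (closure_minimal (fun z hz => ?_) hK)
    by_contra h
    exact hz (hzero z h)
  have h00 : diazSaa q ε (0, 0) = 0 := by
    rw [diazSaa, ← Real.rpow_add (by linarith)]
    simp
  obtain ⟨L, hL⟩ := (hsm.continuous_fderiv (by simp)).bounded_above_of_compact_support
    (hcs.fderiv (𝕜 := ℝ))
  refine ⟨Φ, hsm, ?_, ⟨|L| + 1, by positivity, fun z => (hL z).trans ?_⟩,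
    hsm.continuous.bounded_above_of_compact_support hcs, fun z hz => ?_⟩
  · have : diazSaa q ε 0 = 0 := h00
    simp [hΦ, this]
  · linarith [le_abs_self L]
  · simp [hΦ, hχ1 _ (Ioo_subset_Icc_self hz.1), hχ1 _ (Ioo_subset_Icc_self hz.2)]

variable {N : ℕ} {Ω : Set (E N)} {p : E N → ℝ} {T : ℝ}

/-- The boundedness in time of the Sobolev norm of a function in `L^∞(0,T; W_0^{1,p(x)})`. -/
theorem MemBochnerW0.exists_sobNorm_lt {v : ℝ → E N → ℝ} {Dv : ℝ → E N → E N}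
    (hv : MemBochnerW0 ⊤ T p Ω v Dv) :
    ∃ K : ℝ, 1 ≤ K ∧ ∀ᵐ t ∂volume.restrict (Ioo 0 T),
      sobNorm p Ω (v t) (Dv t) < ENNReal.ofReal K := by
  have h := hv.2.2.2
  rw [eLpNorm_exponent_top] at h
  set S := eLpNormEssSup (fun t => sobNorm p Ω (v t) (Dv t)) (volume.restrict (Ioo 0 T)) with hS
  refine ⟨S.toReal + 1, by simp, ?_⟩
  filter_upwards [enorm_ae_le_eLpNormEssSup (fun t => sobNorm p Ω (v t) (Dv t))
    (volume.restrict (Ioo 0 T))] with t ht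
  refine lt_of_le_of_lt (b := S) ht ?_
  rw [ENNReal.lt_ofReal_iff_toReal_lt h.ne]
  linarith

/-- The chain rule `MemW0.comp_prodMk` at almost every time. -/
theorem MemBochnerW0.comp_prodMk {P L : ℝ} {Φ : ℝ × ℝ → ℝ} {v w : ℝ → E N → ℝ}
    {Dv Dw : ℝ → E N → E N}
    (hpm : AEMeasurable p (volume.restrict Ω))
    (hp : ∀ᵐ x ∂volume.restrict Ω, 1 ≤ p x ∧ p x ≤ P) (hΩ : volume Ω ≠ ⊤)
    (hΦ : ContDiff ℝ ∞ Φ) (h0 : Φ 0 = 0) (hL0 : 0 < L) (hL : ∀ z, ‖fderiv ℝ Φ z‖ ≤ L)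
    (hv : MemBochnerW0 ⊤ T p Ω v Dv) (hw : MemBochnerW0 ⊤ T p Ω w Dw) :
    MemBochnerW0 1 T p Ω (fun t x => Φ (v t x, w t x))
      (fun t => chainGrad Φ (v t) (w t) (Dv t) (Dw t)) := by
  have hvw := hv.1.prodMk hw.1
  have hp1 : ∀ᵐ x ∂volume.restrict Ω, 1 ≤ p x := hp.mono fun x hx => hx.1
  refine ⟨hΦ.continuous.comp_aestronglyMeasurable hvw, ?_, ?_, ?_⟩
  · exact (((continuous_fderiv_const_apply hΦ _).comp_aestronglyMeasurable hvw).smul hv.2.1).add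
      (((continuous_fderiv_const_apply hΦ _).comp_aestronglyMeasurable hvw).smul hw.2.1)
  · filter_upwards [hv.2.2.1, hw.2.2.1] with t h1 h2
    exact h1.comp_prodMk hpm hp hΩ hΦ h0 hL0 hL h2
  · obtain ⟨K, -, hK⟩ := hv.exists_sobNorm_lt
    obtain ⟨K', -, hK'⟩ := hw.exists_sobNorm_lt
    rw [eLpNorm_one_eq_lintegral_enorm]
    refine lt_of_le_of_lt (lintegral_mono_ae (g := fun _ =>
      ENNReal.ofReal L * (ENNReal.ofReal K + ENNReal.ofReal K')) ?_) ?_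
    · filter_upwards [hv.2.2.1, hw.2.2.1, hK, hK'] with t h1 h2 h3 h4
      have a1 := luxNorm_le_of_norm_le_add (f := fun x => Φ (v t x, w t x)) hL0 hpm hp1 h1.1.1.1
        (g₂ := w t) fun x => by
          have := abs_sub_le_of_fderiv_le hΦ hL0 hL (v t x) (w t x) 0 0
          have h0' : Φ (0, 0) = 0 := h0
          simpa [h0'] using this
      have a2 := luxNorm_le_of_norm_le_add hL0 hpm hp1 h1.1.2.1.1
        (norm_chainGrad_le hL (v t) (w t) (Dv t) (Dw t))
      calc sobNorm p Ω (fun x => Φ (v t x, w t x)) (chainGrad Φ (v t) (w t) (Dv t) (Dw t))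
          ≤ ENNReal.ofReal L * (sobNorm p Ω (v t) (Dv t) + sobNorm p Ω (w t) (Dw t)) := by
            refine (add_le_add a1 a2).trans (le_of_eq ?_)
            simp only [sobNorm]
            ring
        _ ≤ _ := by gcongr
    · rw [lintegral_const]
      refine ENNReal.mul_lt_top (by finiteness) ?_
      simp

/-- The modular of the gradient of a function in `L^∞(0,T; W_0^{1,p(x)})` is integrable over the
cylinder. -/
theorem MemBochnerW0.integrable_modular {P : ℝ} {v : ℝ → E N → ℝ} {Dv : ℝ → E N → E N}
    (hpm : AEMeasurable p (volume.restrict Ω))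
    (hp : ∀ᵐ x ∂volume.restrict Ω, 1 ≤ p x ∧ p x ≤ P)
    (hv : MemBochnerW0 ⊤ T p Ω v Dv) :
    Integrable (fun z : ℝ × E N => ‖Dv z.1 z.2‖ ^ p z.2) (cylMeasure T Ω) := by
  have hm : AEMeasurable (fun z : ℝ × E N => ‖Dv z.1 z.2‖ ^ p z.2) (cylMeasure T Ω) :=
    hv.2.1.norm.aemeasurable.pow hpm.comp_snd
  refine ⟨hm.aestronglyMeasurable, ?_⟩
  rw [hasFiniteIntegral_iff_ofReal (Eventually.of_forall fun z => by positivity), cylMeasure,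
    lintegral_prod _ hm.ennreal_ofReal]
  obtain ⟨K, hK1, hK⟩ := hv.exists_sobNorm_lt
  refine lt_of_le_of_lt (lintegral_mono_ae (g := fun _ => ENNReal.ofReal (K ^ P)) ?_) ?_
  · filter_upwards [hK] with t ht
    exact modular_le_of_luxNorm_lt hK1 (hp.mono fun x hx => ⟨by linarith [hx.1], hx.2⟩)
      (le_add_self.trans_lt ht)
  · rw [lintegral_const]
    refine ENNReal.mul_lt_top (by finiteness) ?_
    simp

theorem aestronglyMeasurable_comp_of_continuousOn {α X Y : Type*} [MeasurableSpace α]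
    {μ : Measure α} [TopologicalSpace X] [MeasurableSpace X] [OpensMeasurableSpace X]
    [NormedAddCommGroup Y] [MeasurableSpace Y] [BorelSpace Y] [SecondCountableTopology Y]
    {F : X → Y} {s : Set X} (hF : ContinuousOn F s) (hs : MeasurableSet s) {k : α → X}
    (hk : AEMeasurable k μ) (hks : ∀ᵐ z ∂μ, k z ∈ s) :
    AEStronglyMeasurable (fun z => F (k z)) μ := by
  classical
  have h : Measurable (s.piecewise F fun _ => 0) := hF.measurable_piecewise continuousOn_const hs
  refine (h.comp_aemeasurable hk).aestronglyMeasurable.congr ?_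
  filter_upwards [hks] with z hz
  exact piecewise_eq_of_mem _ _ _ hz

theorem ae_cylMeasure_of_ae {Q : E N → Prop} (h : ∀ᵐ x ∂volume.restrict Ω, Q x) :
    ∀ᵐ z ∂cylMeasure T Ω, Q z.2 :=
  Measure.quasiMeasurePreserving_snd.ae h

theorem rpow_mul_add_le {a b s : ℝ} (ha : 0 ≤ a) (hb : 0 ≤ b) (hs : 1 ≤ s) :
    a ^ (s - 1) * (a + b) ≤ 2 * (a ^ s + b ^ s) := by
  have hm : 0 ≤ max a b := ha.trans (le_max_left _ _)
  have h1 : a ^ (s - 1) * (a + b) ≤ (max a b) ^ (s - 1) * (2 * max a b) := by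
    have := le_max_left a b
    have := le_max_right a b
    have h0 : 0 ≤ s - 1 := by linarith
    gcongr
    linarith
  have h2 : (max a b) ^ (s - 1) * max a b = (max a b) ^ s := by
    rw [← Real.rpow_add_one' hm (by linarith)]
    ring_nf
  have h3 : (max a b) ^ s ≤ a ^ s + b ^ s := by
    rcases max_choice a b with h | h <;> rw [h]
    · exact le_add_of_nonneg_right (by positivity)
    · exact le_add_of_nonneg_left (by positivity)
  linarith

/-- The diffusion term is integrable: the flux of `Dv` grows like `‖Dv‖ ^ (p(x) - 1)`, and
`a ^ (s - 1) * (a + b)` is bounded by modulars. -/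
theorem IsLerayLions.integrable_flux {P L q : ℝ} {A : E N → E N → ℝ} {v w : ℝ → E N → ℝ}
    {Dv Dw Dφ : ℝ → E N → E N} (hA : IsLerayLions Ω p A) (hΩ : IsOpen Ω) (hq : 1 < q)
    (hqp : ∀ x ∈ Ω, q < p x) (hpm : AEMeasurable p (volume.restrict Ω))
    (hp : ∀ᵐ x ∂volume.restrict Ω, 1 ≤ p x ∧ p x ≤ P)
    (hv : MemBochnerW0 ⊤ T p Ω v Dv) (hw : MemBochnerW0 ⊤ T p Ω w Dw)
    (hDφm : AEStronglyMeasurable (fun z : ℝ × E N => Dφ z.1 z.2) (cylMeasure T Ω))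
    (hDφ : ∀ t x, ‖Dφ t x‖ ≤ L * (‖Dv t x‖ + ‖Dw t x‖)) :
    Integrable (fun z : ℝ × E N => inner ℝ (fluxField p A z.2 (Dv z.1 z.2)) (Dφ z.1 z.2))
      (cylMeasure T Ω) := by
  obtain ⟨C, hC0, hC⟩ := hA.exists_norm_flux_le hΩ hq hqp
  have hm : AEStronglyMeasurable (fun z : ℝ × E N => fluxField p A z.2 (Dv z.1 z.2))
      (cylMeasure T Ω) :=
    aestronglyMeasurable_comp_of_continuousOn (k := fun z : ℝ × E N => (z.2, Dv z.1 z.2))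
      hA.flux_continuousOn (hΩ.measurableSet.prod MeasurableSet.univ)
      (measurable_snd.aemeasurable.prodMk hv.2.1.aemeasurable)
      ((ae_cylMeasure_of_ae (ae_restrict_mem hΩ.measurableSet)).mono fun z hz => ⟨hz, mem_univ _⟩)
  refine (((hv.integrable_modular hpm hp).add (hw.integrable_modular hpm hp)).const_mul
    (C * |L| * 2)).mono' (hm.inner hDφm) ?_
  filter_upwards [ae_cylMeasure_of_ae hC, ae_cylMeasure_of_ae hp] with z h1 h2
  have h3 := rpow_mul_add_le (norm_nonneg (Dv z.1 z.2)) (norm_nonneg (Dw z.1 z.2)) h2.1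
  calc ‖inner ℝ (fluxField p A z.2 (Dv z.1 z.2)) (Dφ z.1 z.2)‖
      ≤ ‖fluxField p A z.2 (Dv z.1 z.2)‖ * ‖Dφ z.1 z.2‖ := norm_inner_le_norm _ _
    _ ≤ (C * ‖Dv z.1 z.2‖ ^ (p z.2 - 1)) * (|L| * (‖Dv z.1 z.2‖ + ‖Dw z.1 z.2‖)) := by
        gcongr
        · exact h1 _
        · refine (hDφ _ _).trans ?_
          gcongr
          exact le_abs_self L
    _ = C * |L| * (‖Dv z.1 z.2‖ ^ (p z.2 - 1) * (‖Dv z.1 z.2‖ + ‖Dw z.1 z.2‖)) := by ring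
    _ ≤ C * |L| * (2 * (‖Dv z.1 z.2‖ ^ p z.2 + ‖Dw z.1 z.2‖ ^ p z.2)) := by gcongr
    _ = _ := by
        simp only [Pi.add_apply]
        ring

end TestFunctions

/-! ### Comparison of two solutions -/

section Comparison

variable {N : ℕ} {Ω : Set (E N)} {p : E N → ℝ} {T q M : ℝ} {A : E N → E N → ℝ}
  {f : E N → ℝ → ℝ}

/-- The weak form of the equation for a function with values in `(0,M)`, with gradient `Dv` and
time derivative `V'` of `v ^ q`. -/
structure IsBoundedSolution (Ω : Set (E N)) (T q M : ℝ) (p : E N → ℝ) (A : E N → E N → ℝ)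
    (f : E N → ℝ → ℝ) (h v : ℝ → E N → ℝ) (Dv : ℝ → E N → E N) (V' : ℝ → E N → ℝ) : Prop where
  mem_Ioo : ∀ᵐ z ∂cylMeasure T Ω, v z.1 z.2 ∈ Ioo 0 M
  bochner : MemBochnerW0 ⊤ T p Ω v Dv
  potential : MemLp (fun z : ℝ × E N => h z.1 z.2) 2 (cylMeasure T Ω)
  deriv : MemLp (fun z : ℝ × E N => V' z.1 z.2) 2 (cylMeasure T Ω)
  weak : ∀ (φ : ℝ → E N → ℝ) (Dφ : ℝ → E N → E N),
    MemLp (fun z : ℝ × E N => φ z.1 z.2) 2 (cylMeasure T Ω) → MemBochnerW0 1 T p Ω φ Dφ →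
    ∀ t ∈ Ioc 0 T,
      (∫ z, V' z.1 z.2 * v z.1 z.2 ^ (q - 1) * φ z.1 z.2 ∂(cylMeasure t Ω)) +
        (∫ z, inner ℝ (fluxField p A z.2 (Dv z.1 z.2)) (Dφ z.1 z.2) ∂(cylMeasure t Ω)) =
      ∫ z, (h z.1 z.2 * v z.1 z.2 ^ (q - 1) + f z.2 (v z.1 z.2)) * φ z.1 z.2 ∂(cylMeasure t Ω)

variable {h h' v w V' W' : ℝ → E N → ℝ} {Dv Dw : ℝ → E N → E N}

theorem IsBoundedSolution.integrable_mul_rpow (hv : IsBoundedSolution Ω T q M p A f h v Dv V')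
    (hΩv : volume Ω ≠ ⊤) (hq : 1 < q) {g φ : ℝ × E N → ℝ} {C : ℝ}
    (hg : MemLp g 2 (cylMeasure T Ω))
    (hφm : AEStronglyMeasurable φ (cylMeasure T Ω)) (hφ : ∀ z, ‖φ z‖ ≤ C) :
    Integrable (fun z => g z * (v z.1 z.2 ^ (q - 1) * φ z)) (cylMeasure T Ω) := by
  have := isFiniteMeasure_cylMeasure (T := T) hΩv
  refine (hg.integrable (by simp)).mul_bdd (c := M ^ (q - 1) * C)
    ((hv.bochner.1.aemeasurable.pow_const _).aestronglyMeasurable.mul hφm) ?_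
  filter_upwards [hv.mem_Ioo] with z hz
  have h1 : 0 ≤ v z.1 z.2 := hz.1.le
  have h2 := hz.2.le
  have hq' : 0 ≤ q - 1 := by linarith
  have hM : 0 ≤ M := h1.trans h2
  rw [norm_mul, Real.norm_of_nonneg (by positivity)]
  have := hφ z
  gcongr

theorem IsSource.exists_bound (hf : IsSource Ω q f) (hΩb : Bornology.IsBounded Ω) :
    ∃ C : ℝ, 0 ≤ C ∧ ∀ x ∈ Ω, ∀ s ∈ Icc 0 M, f x s ≤ C := by
  have hK : IsCompact (closure Ω ×ˢ Icc (0 : ℝ) M) := hΩb.isCompact_closure.prod isCompact_Icc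
  obtain ⟨C, hC⟩ := hK.exists_bound_of_continuousOn
    (hf.continuousOn.mono (prod_mono subset_rfl Icc_subset_Ici_self))
  exact ⟨|C|, abs_nonneg C, fun x hx s hs =>
    (le_abs_self _).trans ((hC (x, s) ⟨subset_closure hx, hs⟩).trans (le_abs_self C))⟩

theorem IsBoundedSolution.aestronglyMeasurable_source
    (hv : IsBoundedSolution Ω T q M p A f h v Dv V') (hf : IsSource Ω q f) (hΩ : IsOpen Ω) :
    AEStronglyMeasurable (fun z : ℝ × E N => f z.2 (v z.1 z.2)) (cylMeasure T Ω) := by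
  refine aestronglyMeasurable_comp_of_continuousOn (k := fun z : ℝ × E N => (z.2, v z.1 z.2))
    hf.continuousOn (isClosed_closure.measurableSet.prod measurableSet_Ici)
    (measurable_snd.aemeasurable.prodMk hv.bochner.1.aemeasurable) ?_
  filter_upwards [hv.mem_Ioo, ae_cylMeasure_of_ae (ae_restrict_mem hΩ.measurableSet)] with z h1 h2
  exact ⟨subset_closure h2, h1.1.le⟩

/-- The source terms of the two equations, tested with the functions `diazSaa`. -/
noncomputable def testedSource (q ε : ℝ) (f : E N → ℝ → ℝ) (x : E N) (a b : ℝ) : ℝ :=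
  f x a * diazSaa q ε (a, b) + f x b * diazSaa q ε (b, a)

/-- The weak forms of the two equations, tested with `diazSaa q ε (v, w)` and
`diazSaa q ε (w, v)` and added. The diffusion terms have a sign by the Picone inequality. -/
theorem tested_inequality {P ε : ℝ} (hε : 0 < ε) (hq : 1 < q) (hM : 0 < M) (hΩ : IsOpen Ω)
    (hΩb : Bornology.IsBounded Ω) (hqp : ∀ x ∈ Ω, q < p x)
    (hpm : AEMeasurable p (volume.restrict Ω))
    (hp : ∀ᵐ x ∂volume.restrict Ω, 1 ≤ p x ∧ p x ≤ P)
    (hA : IsLerayLions Ω p A) (hf : IsSource Ω q f)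
    (hv : IsBoundedSolution Ω T q M p A f h v Dv V')
    (hw : IsBoundedSolution Ω T q M p A f h' w Dw W') {t : ℝ} (ht : t ∈ Ioc 0 T) :
    Integrable (fun z : ℝ × E N => testedSource q ε f z.2 (v z.1 z.2) (w z.1 z.2))
      (cylMeasure t Ω) ∧
    ∫ z, (V' z.1 z.2 - h z.1 z.2) *
          (v z.1 z.2 ^ (q - 1) * diazSaa q ε (v z.1 z.2, w z.1 z.2)) +
        (W' z.1 z.2 - h' z.1 z.2) *
          (w z.1 z.2 ^ (q - 1) * diazSaa q ε (w z.1 z.2, v z.1 z.2)) ∂cylMeasure t Ω ≤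
      ∫ z, testedSource q ε f z.2 (v z.1 z.2) (w z.1 z.2) ∂cylMeasure t Ω := by
  have hΩv : volume Ω ≠ ⊤ := hΩb.measure_lt_top.ne
  have hfin := isFiniteMeasure_cylMeasure (T := T) hΩv
  have hmono := cylMeasure_mono (Ω := Ω) ht.2
  obtain ⟨Φ, hΦ, h0, ⟨L, hL0, hL⟩, ⟨C, hC⟩, hEq⟩ := exists_cutoff_diazSaa (q := q) hε hM
  obtain ⟨Cf, hCf0, hCf⟩ := hf.exists_bound (M := M) hΩb
  have hsq : IsOpen (Ioo (0 : ℝ) M ×ˢ Ioo (0 : ℝ) M) := isOpen_Ioo.prod isOpen_Ioo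
  have hDΦ : ∀ z ∈ Ioo (0 : ℝ) M ×ˢ Ioo (0 : ℝ) M, fderiv ℝ Φ z = fderiv ℝ (diazSaa q ε) z :=
    fun z hz => (hEq.eventuallyEq_of_mem (hsq.mem_nhds hz)).fderiv_eq
  -- The properties of each of the two tested equations.
  have main : ∀ {h h' v w V' W' : ℝ → E N → ℝ} {Dv Dw : ℝ → E N → E N},
      IsBoundedSolution Ω T q M p A f h v Dv V' → IsBoundedSolution Ω T q M p A f h' w Dw W' →
      Integrable (fun z : ℝ × E N => (V' z.1 z.2 - h z.1 z.2) *
        (v z.1 z.2 ^ (q - 1) * Φ (v z.1 z.2, w z.1 z.2))) (cylMeasure t Ω) ∧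
      Integrable (fun z : ℝ × E N => f z.2 (v z.1 z.2) * Φ (v z.1 z.2, w z.1 z.2))
        (cylMeasure t Ω) ∧
      Integrable (fun z : ℝ × E N => inner ℝ (fluxField p A z.2 (Dv z.1 z.2))
        (chainGrad Φ (v z.1) (w z.1) (Dv z.1) (Dw z.1) z.2)) (cylMeasure t Ω) ∧
      (∫ z, (V' z.1 z.2 - h z.1 z.2) *
        (v z.1 z.2 ^ (q - 1) * Φ (v z.1 z.2, w z.1 z.2)) ∂cylMeasure t Ω) +
      (∫ z, inner ℝ (fluxField p A z.2 (Dv z.1 z.2))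
        (chainGrad Φ (v z.1) (w z.1) (Dv z.1) (Dw z.1) z.2) ∂cylMeasure t Ω) =
      ∫ z, f z.2 (v z.1 z.2) * Φ (v z.1 z.2, w z.1 z.2) ∂cylMeasure t Ω := by
    intro h h' v w V' W' Dv Dw hv hw
    have hφm : AEStronglyMeasurable (fun z : ℝ × E N => Φ (v z.1 z.2, w z.1 z.2))
        (cylMeasure T Ω) :=
      hΦ.continuous.comp_aestronglyMeasurable (hv.bochner.1.prodMk hw.bochner.1)
    have hb := hv.bochner.comp_prodMk hpm hp hΩv hΦ h0 hL0 hL hw.bochner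
    have i1 := (hv.integrable_mul_rpow hΩv hq hv.deriv hφm fun z => hC _).mono_measure hmono
    have i2 := (hv.integrable_mul_rpow hΩv hq hv.potential hφm fun z => hC _).mono_measure hmono
    have i3 : Integrable (fun z : ℝ × E N => f z.2 (v z.1 z.2) * Φ (v z.1 z.2, w z.1 z.2))
        (cylMeasure t Ω) := by
      refine Integrable.mono_measure ?_ hmono
      refine Integrable.of_bound ((hv.aestronglyMeasurable_source hf hΩ).mul hφm) (Cf * C) ?_
      filter_upwards [hv.mem_Ioo, ae_cylMeasure_of_ae (ae_restrict_mem hΩ.measurableSet)]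
        with z h1 h2
      rw [norm_mul, Real.norm_of_nonneg (hf.nonneg _ (subset_closure h2) _ h1.1.le)]
      exact mul_le_mul (hCf _ h2 _ (Ioo_subset_Icc_self h1)) (hC _) (norm_nonneg _) hCf0
    have i4 := (hA.integrable_flux hΩ hq hqp hpm hp hv.bochner hw.bochner hb.2.1
      fun t x => norm_chainGrad_le hL (v t) (w t) (Dv t) (Dw t) x).mono_measure hmono
    have hweak := hv.weak _ _ (MemLp.of_bound hφm C (Eventually.of_forall fun z => hC _)) hb t ht
    have e1 : ∀ z : ℝ × E N, (V' z.1 z.2 - h z.1 z.2) *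
        (v z.1 z.2 ^ (q - 1) * Φ (v z.1 z.2, w z.1 z.2)) =
        V' z.1 z.2 * (v z.1 z.2 ^ (q - 1) * Φ (v z.1 z.2, w z.1 z.2)) -
        h z.1 z.2 * (v z.1 z.2 ^ (q - 1) * Φ (v z.1 z.2, w z.1 z.2)) := fun z => by ring
    have e2 : ∀ z : ℝ × E N, (h z.1 z.2 * v z.1 z.2 ^ (q - 1) + f z.2 (v z.1 z.2)) *
        Φ (v z.1 z.2, w z.1 z.2) =
        h z.1 z.2 * (v z.1 z.2 ^ (q - 1) * Φ (v z.1 z.2, w z.1 z.2)) +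
        f z.2 (v z.1 z.2) * Φ (v z.1 z.2, w z.1 z.2) := fun z => by ring
    simp only [e1]
    refine ⟨i1.sub i2, i3, i4, ?_⟩
    simp only [e2, mul_assoc] at hweak
    rw [integral_add i2 i3] at hweak
    rw [integral_sub i1 i2]
    linarith
  obtain ⟨i1, i2, i3, e⟩ := main hv hw
  obtain ⟨j1, j2, j3, e'⟩ := main hw hv
  have hvt := ae_mono hmono hv.mem_Ioo
  have hwt := ae_mono hmono hw.mem_Ioo
  have hsrc : (fun z : ℝ × E N => f z.2 (v z.1 z.2) * Φ (v z.1 z.2, w z.1 z.2) +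
      f z.2 (w z.1 z.2) * Φ (w z.1 z.2, v z.1 z.2)) =ᵐ[cylMeasure t Ω]
      fun z => testedSource q ε f z.2 (v z.1 z.2) (w z.1 z.2) := by
    filter_upwards [hvt, hwt] with z h1 h2
    rw [hEq ⟨h1, h2⟩, hEq ⟨h2, h1⟩, testedSource]
  refine ⟨(i2.add j2).congr hsrc, ?_⟩
  have hdiff : 0 ≤ ∫ z, (inner ℝ (fluxField p A z.2 (Dv z.1 z.2))
      (chainGrad Φ (v z.1) (w z.1) (Dv z.1) (Dw z.1) z.2) +
      inner ℝ (fluxField p A z.2 (Dw z.1 z.2))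
      (chainGrad Φ (w z.1) (v z.1) (Dw z.1) (Dv z.1) z.2)) ∂cylMeasure t Ω := by
    refine integral_nonneg_of_ae ?_
    filter_upwards [hvt, hwt, ae_cylMeasure_of_ae (hA.picone hΩ hq hqp)] with z h1 h2 h3
    have hα : 0 < v z.1 z.2 + ε := by linarith [h1.1]
    have hβ : 0 < w z.1 z.2 + ε := by linarith [h2.1]
    have := h3 _ _ hα hβ (Dv z.1 z.2) (Dw z.1 z.2)
    rw [Pi.zero_apply, chainGrad, chainGrad, hDΦ _ ⟨h1, h2⟩, hDΦ _ ⟨h2, h1⟩,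
      (fderiv_diazSaa hα hβ).1, (fderiv_diazSaa hα hβ).2, (fderiv_diazSaa hβ hα).1,
      (fderiv_diazSaa hβ hα).2]
    exact this
  rw [integral_add i3 j3] at hdiff
  rw [← integral_congr_ae hsrc, integral_add i2 j2]
  have hlhs : ∫ z, (V' z.1 z.2 - h z.1 z.2) *
          (v z.1 z.2 ^ (q - 1) * diazSaa q ε (v z.1 z.2, w z.1 z.2)) +
        (W' z.1 z.2 - h' z.1 z.2) *
          (w z.1 z.2 ^ (q - 1) * diazSaa q ε (w z.1 z.2, v z.1 z.2)) ∂cylMeasure t Ω =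
      ∫ z, (V' z.1 z.2 - h z.1 z.2) *
          (v z.1 z.2 ^ (q - 1) * Φ (v z.1 z.2, w z.1 z.2)) +
        (W' z.1 z.2 - h' z.1 z.2) *
          (w z.1 z.2 ^ (q - 1) * Φ (w z.1 z.2, v z.1 z.2)) ∂cylMeasure t Ω := by
    refine integral_congr_ae ?_
    filter_upwards [hvt, hwt] with z h1 h2
    rw [hEq ⟨h1, h2⟩, hEq ⟨h2, h1⟩]
  rw [hlhs, integral_add i1 j1]
  linarith

theorem diazSaa_eq {ε a b : ℝ} (ha : 0 < a + ε) :
    diazSaa q ε (a, b) = ((a + ε) ^ q - (b + ε) ^ q) * (a + ε) ^ (1 - q) := by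
  rw [diazSaa, sub_mul, ← Real.rpow_add ha]
  simp

/-- The tested time derivatives are bounded uniformly in `ε`, because the weight `a ^ (q - 1)`
compensates the denominator `(a + ε) ^ (q - 1)`. -/
theorem abs_rpow_mul_diazSaa_le {ε a b : ℝ} (hq : 1 < q) (hε : 0 < ε) (hε1 : ε ≤ 1)
    (ha : a ∈ Ioo 0 M) (hb : b ∈ Ioo 0 M) :
    |a ^ (q - 1) * diazSaa q ε (a, b)| ≤ (M + 1) ^ q := by
  have ha0 := ha.1
  have hb0 := hb.1
  have haε : 0 < a + ε := by linarith
  have h1 : a ^ (q - 1) * (a + ε) ^ (1 - q) ≤ 1 := by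
    rw [show 1 - q = -(q - 1) by ring, Real.rpow_neg haε.le, ← div_eq_mul_inv,
      div_le_one (by positivity)]
    have : 0 ≤ q - 1 := by linarith
    gcongr
    linarith
  have h2 : |(a + ε) ^ q - (b + ε) ^ q| ≤ (M + 1) ^ q := by
    have e1 : (a + ε) ^ q ≤ (M + 1) ^ q := by
      gcongr
      linarith [ha.2]
    have e2 : (b + ε) ^ q ≤ (M + 1) ^ q := by
      gcongr
      linarith [hb.2]
    have e3 : 0 ≤ (a + ε) ^ q := by positivity
    have e4 : 0 ≤ (b + ε) ^ q := by positivity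
    rw [abs_le]
    constructor <;> linarith
  rw [diazSaa_eq haε, show a ^ (q - 1) * (((a + ε) ^ q - (b + ε) ^ q) * (a + ε) ^ (1 - q)) =
    (a ^ (q - 1) * (a + ε) ^ (1 - q)) * ((a + ε) ^ q - (b + ε) ^ q) by ring, abs_mul,
    abs_of_nonneg (by positivity)]
  exact (mul_le_mul h1 h2 (abs_nonneg _) zero_le_one).trans (by rw [one_mul])

theorem tendsto_diazSaa {a b : ℝ} (hq : 1 < q) (ha : 0 < a) {ε : ℕ → ℝ}
    (hε : Tendsto ε atTop (𝓝 0)) :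
    Tendsto (fun n => diazSaa q (ε n) (a, b)) atTop (𝓝 (a - b ^ q * a ^ (1 - q))) := by
  have h1 : Tendsto (fun n => a + ε n) atTop (𝓝 a) := by simpa using hε.const_add a
  have h2 : Tendsto (fun n => b + ε n) atTop (𝓝 b) := by simpa using hε.const_add b
  exact h1.sub ((h2.rpow_const (Or.inr (by linarith))).mul (h1.rpow_const (Or.inl ha.ne')))

theorem rpow_sub_one_mul_sub {a b : ℝ} (ha : 0 < a) :
    a ^ (q - 1) * (a - b ^ q * a ^ (1 - q)) = a ^ q - b ^ q := by
  have h1 : a ^ (q - 1) * a = a ^ q := by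
    rw [← Real.rpow_add_one ha.ne']
    simp
  have h2 : a ^ (q - 1) * a ^ (1 - q) = 1 := by
    rw [← Real.rpow_add ha]
    simp
  rw [mul_sub, h1, mul_left_comm, h2, mul_one]

/-- The limit of the tested source terms is
`(f(x,a) / a ^ (q-1) - f(x,b) / b ^ (q-1)) * (a ^ q - b ^ q)`, which is nonpositive. -/
theorem IsSource.limit_nonpos (hf : IsSource Ω q f) (hq : 1 < q) {x : E N} (hx : x ∈ Ω) {a b : ℝ}
    (ha : 0 < a) (hb : 0 < b) :
    f x a * (a - b ^ q * a ^ (1 - q)) + f x b * (b - a ^ q * b ^ (1 - q)) ≤ 0 := by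
  have key : ∀ a b : ℝ, 0 < a → f x a * (a - b ^ q * a ^ (1 - q)) =
      f x a / a ^ (q - 1) * (a ^ q - b ^ q) := fun a b ha => by
    rw [← rpow_sub_one_mul_sub ha]
    field_simp
  rw [key a b ha, key b a hb]
  have hanti := hf.antitone x hx
  have : (f x a / a ^ (q - 1) - f x b / b ^ (q - 1)) * (a ^ q - b ^ q) ≤ 0 := by
    rcases le_total a b with h | h
    · have h1 := hanti (mem_Ioi.2 ha) (mem_Ioi.2 hb) h
      have h2 := Real.rpow_le_rpow ha.le h (by linarith : 0 ≤ q)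
      exact mul_nonpos_of_nonneg_of_nonpos (sub_nonneg.2 h1) (by linarith)
    · have h1 := hanti (mem_Ioi.2 hb) (mem_Ioi.2 ha) h
      have h2 := Real.rpow_le_rpow hb.le h (by linarith : 0 ≤ q)
      exact mul_nonpos_of_nonpos_of_nonneg (sub_nonpos.2 h1) (by linarith)
  linarith

theorem IsSource.testedSource_le (hf : IsSource Ω q f) {x : E N} (hx : x ∈ Ω) {ε a b C : ℝ}
    (hε : 0 < ε) (hε1 : ε ≤ 1) (hC : ∀ x ∈ Ω, ∀ s ∈ Icc 0 M, f x s ≤ C)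
    (ha : a ∈ Ioo 0 M) (hb : b ∈ Ioo 0 M) :
    testedSource q ε f x a b ≤ 2 * (C * (M + 1)) := by
  have key : ∀ a b : ℝ, a ∈ Ioo 0 M → b ∈ Ioo 0 M → f x a * diazSaa q ε (a, b) ≤ C * (M + 1) := by
    intro a b ha hb
    have h1 : diazSaa q ε (a, b) ≤ M + 1 := by
      have : 0 ≤ (b + ε) ^ q * (a + ε) ^ (1 - q) := by
        have := ha.1
        have := hb.1
        positivity
      simp only [diazSaa]
      linarith [ha.2]
    have h2 := hf.nonneg x (subset_closure hx) a ha.1.le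
    exact (mul_le_mul_of_nonneg_left h1 h2).trans
      (mul_le_mul_of_nonneg_right (hC x hx a (Ioo_subset_Icc_self ha)) (by linarith [ha.1, ha.2]))
  rw [testedSource, two_mul]
  exact add_le_add (key a b ha hb) (key b a hb ha)

/-- The difference of the two equations, tested with `v ^ q - w ^ q`. It is the limit `ε → 0` of
`tested_inequality`: the left-hand sides converge by dominated convergence, and the positive parts
of the tested source terms, which are bounded, tend to zero. -/
theorem integral_deriv_le_integral_potential {P : ℝ} (hq : 1 < q) (hM : 0 < M) (hΩ : IsOpen Ω)
    (hΩb : Bornology.IsBounded Ω) (hqp : ∀ x ∈ Ω, q < p x)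
    (hpm : AEMeasurable p (volume.restrict Ω))
    (hp : ∀ᵐ x ∂volume.restrict Ω, 1 ≤ p x ∧ p x ≤ P)
    (hA : IsLerayLions Ω p A) (hf : IsSource Ω q f)
    (hv : IsBoundedSolution Ω T q M p A f h v Dv V')
    (hw : IsBoundedSolution Ω T q M p A f h' w Dw W') {t : ℝ} (ht : t ∈ Ioc 0 T) :
    ∫ z, (V' z.1 z.2 - W' z.1 z.2) * (v z.1 z.2 ^ q - w z.1 z.2 ^ q) ∂cylMeasure t Ω ≤
      ∫ z, (h z.1 z.2 - h' z.1 z.2) * (v z.1 z.2 ^ q - w z.1 z.2 ^ q) ∂cylMeasure t Ω := by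
  have hΩv : volume Ω ≠ ⊤ := hΩb.measure_lt_top.ne
  have hfin := isFiniteMeasure_cylMeasure (T := t) hΩv
  have hmono := cylMeasure_mono (Ω := Ω) ht.2
  obtain ⟨C, hC0, hC⟩ := hf.exists_bound (M := M) hΩb
  set ε : ℕ → ℝ := fun n => 1 / ((n : ℝ) + 1) with hεdef
  have hε0 : ∀ n, 0 < ε n := fun n => by positivity
  have hε1 : ∀ n, ε n ≤ 1 := fun n => by
    rw [hεdef]
    exact (div_le_one (by positivity)).2 (by linarith [n.cast_nonneg (α := ℝ)])
  have hε : Tendsto ε atTop (𝓝 0) := tendsto_one_div_add_atTop_nhds_zero_nat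
  have hvt := ae_mono hmono hv.mem_Ioo
  have hwt := ae_mono hmono hw.mem_Ioo
  have hvm := (hv.bochner.1.mono_measure hmono).aemeasurable
  have hwm := (hw.bochner.1.mono_measure hmono).aemeasurable
  have hV := hv.deriv.mono_measure hmono
  have hW := hw.deriv.mono_measure hmono
  have hh := hv.potential.mono_measure hmono
  have hh' := hw.potential.mono_measure hmono
  have hxΩ : ∀ᵐ z ∂cylMeasure t Ω, z.2 ∈ Ω :=
    ae_cylMeasure_of_ae (ae_restrict_mem hΩ.measurableSet)
  have hVh : Integrable (fun z : ℝ × E N => V' z.1 z.2 - h z.1 z.2) (cylMeasure t Ω) :=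
    (hV.sub hh).integrable (by simp)
  have hWh : Integrable (fun z : ℝ × E N => W' z.1 z.2 - h' z.1 z.2) (cylMeasure t Ω) :=
    (hW.sub hh').integrable (by simp)
  have hdm : ∀ {v w : ℝ → E N → ℝ} (n : ℕ),
      AEMeasurable (fun z : ℝ × E N => v z.1 z.2) (cylMeasure t Ω) →
      AEMeasurable (fun z : ℝ × E N => w z.1 z.2) (cylMeasure t Ω) →
      AEStronglyMeasurable (fun z : ℝ × E N => v z.1 z.2 ^ (q - 1) *
        diazSaa q (ε n) (v z.1 z.2, w z.1 z.2)) (cylMeasure t Ω) := fun n h1 h2 =>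
    ((h1.pow_const _).mul ((h1.add_const _).sub
      (((h2.add_const _).pow_const _).mul ((h1.add_const _).pow_const _)))).aestronglyMeasurable
  -- The left-hand sides.
  have hlim : Tendsto (fun n => ∫ z, (V' z.1 z.2 - h z.1 z.2) *
          (v z.1 z.2 ^ (q - 1) * diazSaa q (ε n) (v z.1 z.2, w z.1 z.2)) +
        (W' z.1 z.2 - h' z.1 z.2) *
          (w z.1 z.2 ^ (q - 1) * diazSaa q (ε n) (w z.1 z.2, v z.1 z.2)) ∂cylMeasure t Ω) atTop
      (𝓝 (∫ z, ((V' z.1 z.2 - h z.1 z.2) * (v z.1 z.2 ^ q - w z.1 z.2 ^ q) +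
        (W' z.1 z.2 - h' z.1 z.2) * (w z.1 z.2 ^ q - v z.1 z.2 ^ q)) ∂cylMeasure t Ω)) := by
    refine tendsto_integral_of_dominated_convergence
      (fun z : ℝ × E N => ‖V' z.1 z.2 - h z.1 z.2‖ * (M + 1) ^ q +
        ‖W' z.1 z.2 - h' z.1 z.2‖ * (M + 1) ^ q) ?_ ?_ ?_ ?_
    · exact fun n => (hVh.1.mul (hdm n hvm hwm)).add (hWh.1.mul (hdm n hwm hvm))
    · exact (hVh.norm.mul_const _).add (hWh.norm.mul_const _)
    · intro n
      filter_upwards [hvt, hwt] with z h1 h2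
      refine (norm_add_le _ _).trans ?_
      rw [norm_mul (V' z.1 z.2 - h z.1 z.2), norm_mul (W' z.1 z.2 - h' z.1 z.2)]
      have e1 := abs_rpow_mul_diazSaa_le hq (hε0 n) (hε1 n) h1 h2
      have e2 := abs_rpow_mul_diazSaa_le hq (hε0 n) (hε1 n) h2 h1
      rw [← Real.norm_eq_abs] at e1 e2
      gcongr
    · filter_upwards [hvt, hwt] with z h1 h2
      have e1 := (tendsto_diazSaa (b := w z.1 z.2) hq h1.1 hε).const_mul (v z.1 z.2 ^ (q - 1))
      have e2 := (tendsto_diazSaa (b := v z.1 z.2) hq h2.1 hε).const_mul (w z.1 z.2 ^ (q - 1))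
      rw [rpow_sub_one_mul_sub h1.1] at e1
      rw [rpow_sub_one_mul_sub h2.1] at e2
      exact (e1.const_mul _).add (e2.const_mul _)
  have htest := fun n => tested_inequality (hε0 n) hq hM hΩ hΩb hqp hpm hp hA hf hv hw ht
  -- The positive parts of the right-hand sides.
  have hpos : Tendsto (fun n => ∫ z, max (testedSource q (ε n) f z.2 (v z.1 z.2) (w z.1 z.2)) 0
      ∂cylMeasure t Ω) atTop (𝓝 (∫ _, (0 : ℝ) ∂cylMeasure t Ω)) := by
    refine tendsto_integral_of_dominated_convergence (fun _ => 2 * (C * (M + 1))) ?_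
      (integrable_const _) ?_ ?_
    · exact fun n => (htest n).1.pos_part.1
    · intro n
      filter_upwards [hvt, hwt, hxΩ] with z h1 h2 h3
      rw [Real.norm_of_nonneg (le_max_right _ _)]
      exact max_le (hf.testedSource_le h3 (hε0 n) (hε1 n) hC h1 h2) (by positivity)
    · filter_upwards [hvt, hwt, hxΩ] with z h1 h2 h3
      have e1 := (tendsto_diazSaa (b := w z.1 z.2) hq h1.1 hε).const_mul (f z.2 (v z.1 z.2))
      have e2 := (tendsto_diazSaa (b := v z.1 z.2) hq h2.1 hε).const_mul (f z.2 (w z.1 z.2))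
      have e3 := (e1.add e2).max (tendsto_const_nhds (x := (0 : ℝ)))
      rw [max_eq_right (hf.limit_nonpos hq h3 h1.1 h2.1)] at e3
      exact e3
  rw [integral_zero] at hpos
  have hle := le_of_tendsto_of_tendsto' hlim hpos fun n =>
    (htest n).2.trans (integral_mono (htest n).1 (htest n).1.pos_part fun z => le_max_left _ _)
  have hUb : MemLp (fun z : ℝ × E N => v z.1 z.2 ^ q - w z.1 z.2 ^ q) ⊤ (cylMeasure t Ω) := by
    refine memLp_top_of_bound
      ((hvm.pow_const _).sub (hwm.pow_const _)).aestronglyMeasurable (M ^ q) ?_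
    filter_upwards [hvt, hwt] with z h1 h2
    have a1 := h1.1.le
    have a2 := h2.1.le
    have e1 : v z.1 z.2 ^ q ≤ M ^ q := by gcongr; exact h1.2.le
    have e2 : w z.1 z.2 ^ q ≤ M ^ q := by gcongr; exact h2.2.le
    have e3 : 0 ≤ v z.1 z.2 ^ q := by positivity
    have e4 : 0 ≤ w z.1 z.2 ^ q := by positivity
    rw [Real.norm_eq_abs, abs_le]
    constructor <;> linarith
  have hU2 := hUb.mono_exponent (p := 2) le_top
  have k1 := (hV.sub hW).integrable_mul hU2
  have k2 := (hh.sub hh').integrable_mul hU2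
  rw [← sub_nonpos]
  refine le_trans (le_of_eq ?_) hle
  refine (integral_sub k1 k2).symm.trans ?_
  refine integral_congr_ae (Eventually.of_forall fun z => ?_)
  simp only [Pi.mul_apply, Pi.sub_apply]
  ring

end Comparison

/-! ### The contraction estimate -/

section Contraction

variable {N : ℕ} {Ω : Set (E N)} {p : E N → ℝ} {T q M : ℝ} {A : E N → E N → ℝ}
  {f : E N → ℝ → ℝ}

/-- The bound `M` is left free so that two solutions can share one. -/
theorem IsWeakSolution.exists_isBoundedSolution {h v : ℝ → E N → ℝ} {v₀ : E N → ℝ}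
    (hh : MemLp (fun z : ℝ × E N => h z.1 z.2) 2 (cylMeasure T Ω))
    (hv : IsWeakSolution Ω T q p A f h v₀ v) :
    ∃ (Dv : ℝ → E N → E N) (V' : ℝ → E N → ℝ) (M₀ : ℝ),
      IsWeakTimeDeriv T Ω (fun t x => v t x ^ q) V' ∧
        ∀ M ≥ M₀, IsBoundedSolution Ω T q M p A f h v Dv V' := by
  obtain ⟨hpos, -, hbdd, -, -, Dv, V', hb, hV', hw, hweak⟩ := hv
  have hfin := hbdd.2
  rw [eLpNorm_exponent_top] at hfin
  refine ⟨Dv, V', (eLpNormEssSup (fun z : ℝ × E N => v z.1 z.2) (cylMeasure T Ω)).toReal + 1, hw,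
    fun M hM => ⟨?_, hb, hh, hV', hweak⟩⟩
  filter_upwards [hpos, enorm_ae_le_eLpNormEssSup (fun z : ℝ × E N => v z.1 z.2)
    (cylMeasure T Ω)] with z h1 h2
  have h3 := ENNReal.toReal_mono hfin.ne h2
  rw [toReal_enorm, Real.norm_of_nonneg h1.le] at h3
  exact ⟨h1, by linarith⟩

theorem IsContinuousL2.sub {U W : ℝ → E N → ℝ} (hU : IsContinuousL2 T Ω U)
    (hW : IsContinuousL2 T Ω W) : IsContinuousL2 T Ω (fun t x => U t x - W t x) := by
  refine fun t ht => ⟨(hU t ht).1.sub (hW t ht).1, ?_⟩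
  have hlim := (hU t ht).2.add (hW t ht).2
  rw [add_zero] at hlim
  refine tendsto_of_tendsto_of_tendsto_of_le_of_le' tendsto_const_nhds hlim
    (Eventually.of_forall fun _ => zero_le) (eventually_nhdsWithin_of_forall fun s hs => ?_)
  refine le_trans (le_of_eq ?_) (eLpNorm_sub_le ((hU s hs).1.1.sub (hU t ht).1.1)
    ((hW s hs).1.1.sub (hW t ht).1.1) (by norm_num))
  congr 1
  ext x
  simp only [Pi.sub_apply]
  ring

theorem IsWeakTimeDeriv.sub {U U' W W' : ℝ → E N → ℝ}
    (hUi : Integrable (fun z : ℝ × E N => U z.1 z.2) (cylMeasure T Ω))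
    (hU'i : Integrable (fun z : ℝ × E N => U' z.1 z.2) (cylMeasure T Ω))
    (hWi : Integrable (fun z : ℝ × E N => W z.1 z.2) (cylMeasure T Ω))
    (hW'i : Integrable (fun z : ℝ × E N => W' z.1 z.2) (cylMeasure T Ω))
    (hU : IsWeakTimeDeriv T Ω U U') (hW : IsWeakTimeDeriv T Ω W W') :
    IsWeakTimeDeriv T Ω (fun t x => U t x - W t x) (fun t x => U' t x - W' t x) := by
  intro ψ h1 h2 h3
  have hd : ∀ z : ℝ × E N, deriv (fun s => ψ (s, z.2)) z.1 = fderiv ℝ ψ z (1, 0) := fun z =>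
    ((h1.differentiable (by simp) z).hasFDerivAt.comp_hasDerivAt_of_eq z.1
      ((hasDerivAt_id z.1).prodMk (hasDerivAt_const z.1 z.2)) rfl).deriv
  have hc : Continuous fun z => fderiv ℝ ψ z ((1, 0) : ℝ × E N) :=
    (h1.continuous_fderiv (by simp)).clm_apply continuous_const
  obtain ⟨C, hC⟩ := hc.bounded_above_of_compact_support (h2.fderiv_apply (𝕜 := ℝ) _)
  obtain ⟨C', hC'⟩ := h1.continuous.bounded_above_of_compact_support h2
  have e1 := hU ψ h1 h2 h3
  have e2 := hW ψ h1 h2 h3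
  simp only [hd] at e1 e2 ⊢
  have b1 : ∀ {g : ℝ × E N → ℝ}, Integrable g (cylMeasure T Ω) →
      Integrable (fun z => g z * fderiv ℝ ψ z (1, 0)) (cylMeasure T Ω) := fun hg =>
    hg.mul_bdd (c := C) hc.aestronglyMeasurable (Eventually.of_forall hC)
  have b2 : ∀ {g : ℝ × E N → ℝ}, Integrable g (cylMeasure T Ω) →
      Integrable (fun z => g z * ψ z) (cylMeasure T Ω) := fun hg =>
    hg.mul_bdd (c := C') h1.continuous.aestronglyMeasurable (Eventually.of_forall hC')
  simp only [sub_mul]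
  rw [integral_sub (b1 hUi) (b1 hWi), integral_sub (b2 hU'i) (b2 hW'i), e1, e2]
  ring

theorem integral_mul_le_eLpNorm_mul_eLpNorm {α : Type*} [MeasurableSpace α] {μ : Measure α}
    {f g : α → ℝ} (hf : MemLp f 2 μ) (hg : MemLp g 2 μ) :
    ∫ x, f x * g x ∂μ ≤ (eLpNorm f 2 μ).toReal * (eLpNorm g 2 μ).toReal := by
  have h := real_inner_le_norm (hf.toLp f) (hg.toLp g)
  rw [L2.inner_def, Lp.norm_toLp, Lp.norm_toLp] at h
  refine le_trans (le_of_eq (integral_congr_ae ?_)) h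
  filter_upwards [hf.coeFn_toLp, hg.coeFn_toLp] with x h1 h2
  rw [h1, h2]
  simp [mul_comm]

theorem ae_memLp_section {H : ℝ → E N → ℝ}
    (hg : MemLp (fun z : ℝ × E N => H z.1 z.2) 2 (cylMeasure T Ω)) :
    ∀ᵐ s ∂volume.restrict (Ioo 0 T), MemLp (H s) 2 (volume.restrict Ω) := by
  have h2 := hg.integrable_sq.prod_right_ae
  filter_upwards [hg.1.prodMk_left, h2] with s h3 h4
  exact (memLp_two_iff_integrable_sq h3).2 h4

theorem integrableOn_eLpNorm_section {H : ℝ → E N → ℝ}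
    (hg : MemLp (fun z : ℝ × E N => H z.1 z.2) 2 (cylMeasure T Ω)) :
    IntegrableOn (fun s => (eLpNorm (H s) 2 (volume.restrict Ω)).toReal) (Ioo 0 T) := by
  have hI : Integrable (fun s => ∫ x in Ω, H s x ^ 2) (volume.restrict (Ioo 0 T)) :=
    hg.integrable_sq.integral_prod_left
  have hae : ∀ᵐ s ∂volume.restrict (Ioo 0 T), √(∫ x in Ω, H s x ^ 2) =
      (eLpNorm (H s) 2 (volume.restrict Ω)).toReal := by
    filter_upwards [ae_memLp_section hg] with s hs
    rw [← sq_toReal_eLpNorm_two hs, Real.sqrt_sq ENNReal.toReal_nonneg]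
  refine Integrable.congr (MemLp.integrable (q := 2) (by norm_num) ?_) hae
  refine (memLp_two_iff_integrable_sq ?_).2 (hI.congr ?_)
  · exact Real.continuous_sqrt.comp_aestronglyMeasurable hI.1
  · exact Eventually.of_forall fun s => (Real.sq_sqrt (integral_nonneg fun x => sq_nonneg _)).symm

variable {H U : ℝ → E N → ℝ}

/-- The Cauchy-Schwarz inequality in space, integrated in time. -/
theorem integral_cylMeasure_mul_le
    (hH : MemLp (fun z : ℝ × E N => H z.1 z.2) 2 (cylMeasure T Ω))
    (hU : MemLp (fun z : ℝ × E N => U z.1 z.2) 2 (cylMeasure T Ω))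
    (hUc : IsContinuousL2 T Ω U) {t : ℝ} (ht : t ∈ Icc 0 T) :
    ∫ z, H z.1 z.2 * U z.1 z.2 ∂cylMeasure t Ω ≤
      ∫ s in (0 : ℝ)..t, (eLpNorm (H s) 2 (volume.restrict Ω)).toReal *
        (eLpNorm (U s) 2 (volume.restrict Ω)).toReal := by
  have hmono := cylMeasure_mono (Ω := Ω) ht.2
  have hi : Integrable (fun z : ℝ × E N => H z.1 z.2 * U z.1 z.2) (cylMeasure t Ω) :=
    (hH.integrable_mul hU).mono_measure hmono
  have hg : IntervalIntegrable (fun s => (eLpNorm (H s) 2 (volume.restrict Ω)).toReal)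
      volume 0 t := by
    rw [intervalIntegrable_iff_integrableOn_Ioo_of_le ht.1]
    exact integrableOn_eLpNorm_section (hH.mono_measure hmono)
  have hgy := hg.mul_continuousOn (g := fun s => (eLpNorm (U s) 2 (volume.restrict Ω)).toReal)
    (by
      rw [uIcc_of_le ht.1]
      exact hUc.continuousOn_norm.mono (Icc_subset_Icc_right ht.2))
  rw [intervalIntegrable_iff_integrableOn_Ioo_of_le ht.1] at hgy
  rw [cylMeasure] at hi ⊢
  rw [integral_prod _ hi, intervalIntegral.integral_of_le ht.1, integral_Ioc_eq_integral_Ioo]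
  refine integral_mono_ae hi.integral_prod_left hgy ?_
  filter_upwards [ae_memLp_section (hH.mono_measure hmono), ae_restrict_mem measurableSet_Ioo]
    with s h1 h2
  exact integral_mul_le_eLpNorm_mul_eLpNorm h1 (hUc s ⟨h2.1.le, h2.2.le.trans ht.2⟩).1

/-- The energy inequality `‖U(t)‖² ≤ ‖U(0)‖² + 2 ∫_0^t ∫_Ω H U` implies the linear estimate
`‖U(t)‖ ≤ ‖U(0)‖ + ∫_0^t ‖H‖`. -/
theorem eLpNorm_le_of_energy_inequality (hT : 0 < T)
    (hH : MemLp (fun z : ℝ × E N => H z.1 z.2) 2 (cylMeasure T Ω))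
    (hU : MemLp (fun z : ℝ × E N => U z.1 z.2) 2 (cylMeasure T Ω))
    (hUc : IsContinuousL2 T Ω U)
    (hen : ∀ t ∈ Ioc 0 T, ∫ x in Ω, U t x ^ 2 ≤
      (∫ x in Ω, U 0 x ^ 2) + 2 * ∫ z, H z.1 z.2 * U z.1 z.2 ∂cylMeasure t Ω)
    {t : ℝ} (ht : t ∈ Icc 0 T) :
    eLpNorm (U t) 2 (volume.restrict Ω) ≤ eLpNorm (U 0) 2 (volume.restrict Ω) +
      ∫⁻ s in Ioc 0 t, eLpNorm (H s) 2 (volume.restrict Ω) := by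
  have h0T : (0 : ℝ) ∈ Icc 0 T := ⟨le_rfl, hT.le⟩
  have hgi : IntegrableOn (fun s => (eLpNorm (H s) 2 (volume.restrict Ω)).toReal) (Ioo 0 T) :=
    integrableOn_eLpNorm_section hH
  have hgI : IntervalIntegrable (fun s => (eLpNorm (H s) 2 (volume.restrict Ω)).toReal)
      volume 0 T := by
    rwa [intervalIntegrable_iff_integrableOn_Ioo_of_le hT.le]
  have hfinal := le_add_integral_of_sq_le
    (y := fun t => (eLpNorm (U t) 2 (volume.restrict Ω)).toReal) hUc.continuousOn_norm
    (fun _ _ => ENNReal.toReal_nonneg) hgI (fun _ => ENNReal.toReal_nonneg) (fun s hs => by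
      have hs' : s ∈ Icc 0 T := ⟨hs.1.le, hs.2⟩
      rw [sq_toReal_eLpNorm_two (hUc s hs').1, sq_toReal_eLpNorm_two (hUc 0 h0T).1]
      linarith [hen s hs, integral_cylMeasure_mul_le hH hU hUc hs']) ht
  have hgt : IntegrableOn (fun s => (eLpNorm (H s) 2 (volume.restrict Ω)).toReal) (Ioc 0 t) := by
    rw [integrableOn_Ioc_iff_integrableOn_Ioo]
    exact hgi.mono_set (Ioo_subset_Ioo_right ht.2)
  rw [intervalIntegral.integral_of_le ht.1] at hfinal
  calc eLpNorm (U t) 2 (volume.restrict Ω)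
      = ENNReal.ofReal (eLpNorm (U t) 2 (volume.restrict Ω)).toReal :=
        (ENNReal.ofReal_toReal (hUc t ht).1.2.ne).symm
    _ ≤ ENNReal.ofReal (eLpNorm (U 0) 2 (volume.restrict Ω)).toReal + ENNReal.ofReal
          (∫ s in Ioc 0 t, (eLpNorm (H s) 2 (volume.restrict Ω)).toReal) := by
        rw [← ENNReal.ofReal_add ENNReal.toReal_nonneg
          (integral_nonneg fun _ => ENNReal.toReal_nonneg)]
        exact ENNReal.ofReal_le_ofReal hfinal
    _ ≤ _ := by
        rw [ofReal_integral_eq_lintegral_ofReal hgt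
          (Eventually.of_forall fun _ => ENNReal.toReal_nonneg)]
        exact add_le_add ENNReal.ofReal_toReal_le
          (lintegral_mono fun s => ENNReal.ofReal_toReal_le)

/-- Powers of bounded positive functions are square integrable over the cylinder. -/
theorem IsBoundedSolution.memLp_rpow {h v V' : ℝ → E N → ℝ} {Dv : ℝ → E N → E N}
    (hv : IsBoundedSolution Ω T q M p A f h v Dv V') (hΩv : volume Ω ≠ ⊤) (hq : 1 < q) :
    MemLp (fun z : ℝ × E N => v z.1 z.2 ^ q) 2 (cylMeasure T Ω) := by
  have := isFiniteMeasure_cylMeasure (T := T) hΩv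
  refine MemLp.of_bound (hv.bochner.1.aemeasurable.pow_const _).aestronglyMeasurable (M ^ q) ?_
  filter_upwards [hv.mem_Ioo] with z hz
  have h1 := hz.1.le
  rw [Real.norm_of_nonneg (by positivity)]
  gcongr
  exact hz.2.le

end Contraction

end DNE

theorem mainTheorem2 {N : ℕ} (hN : 1 ≤ N) (Ω : Set (DNE.E N)) (hΩ : IsOpen Ω)
    (hΩb : Bornology.IsBounded Ω) (T : ℝ) (hT : 0 < T)
    (q : ℝ) (hq : 1 < q)
    (p : DNE.E N → ℝ) (hp : DNE.IsC1Closure Ω p) (hqp : ∀ x ∈ closure Ω, q < p x)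
    (A : DNE.E N → DNE.E N → ℝ) (hA : DNE.IsLerayLions Ω p A)
    (f : DNE.E N → ℝ → ℝ) (hf : DNE.IsSource Ω q f)
    (h h' : ℝ → DNE.E N → ℝ)
    (hh : MemLp (fun z : ℝ × DNE.E N => h z.1 z.2) 2 (DNE.cylMeasure T Ω))
    (hh' : MemLp (fun z : ℝ × DNE.E N => h' z.1 z.2) 2 (DNE.cylMeasure T Ω))
    (v₀ w₀ : DNE.E N → ℝ)
    (hv₀ : MemLp v₀ (ENNReal.ofReal (2 * q)) (volume.restrict Ω))
    (hw₀ : MemLp w₀ (ENNReal.ofReal (2 * q)) (volume.restrict Ω))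
    (hv₀_nonneg : ∀ᵐ x ∂(volume.restrict Ω), 0 ≤ v₀ x)
    (hw₀_nonneg : ∀ᵐ x ∂(volume.restrict Ω), 0 ≤ w₀ x)
    (v w : ℝ → DNE.E N → ℝ)
    (hv : DNE.IsWeakSolution Ω T q p A f h v₀ v)
    (hw : DNE.IsWeakSolution Ω T q p A f h' w₀ w) :
    ∀ t ∈ Icc 0 T,
      eLpNorm (fun x => v t x ^ q - w t x ^ q) 2 (volume.restrict Ω) ≤
        eLpNorm (fun x => v₀ x ^ q - w₀ x ^ q) 2 (volume.restrict Ω) +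
          ∫⁻ s in Ioc 0 t, eLpNorm (fun x => h s x - h' s x) 2 (volume.restrict Ω) := by
  intro t ht
  have hΩv : volume Ω ≠ ⊤ := hΩb.measure_lt_top.ne
  have hfin := DNE.isFiniteMeasure_cylMeasure (T := T) hΩv
  obtain ⟨P, hP⟩ := hΩb.isCompact_closure.exists_bound_of_continuousOn hp.1
  have hqpΩ : ∀ x ∈ Ω, q < p x := fun x hx => hqp x (subset_closure hx)
  have hpm : AEMeasurable p (volume.restrict Ω) :=
    (hp.1.mono subset_closure).aemeasurable hΩ.measurableSet
  have hpP : ∀ᵐ x ∂volume.restrict Ω, 1 ≤ p x ∧ p x ≤ P := by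
    filter_upwards [ae_restrict_mem hΩ.measurableSet] with x hx
    exact ⟨(hq.trans (hqpΩ x hx)).le, (le_abs_self _).trans (hP x (subset_closure hx))⟩
  obtain ⟨Dv, V', M₁, hvd, hvM⟩ := hv.exists_isBoundedSolution hh
  obtain ⟨Dw, W', M₂, hwd, hwM⟩ := hw.exists_isBoundedSolution hh'
  set M : ℝ := max 1 (max M₁ M₂) with hMdef
  have hM : 0 < M := lt_of_lt_of_le one_pos (le_max_left _ _)
  have hvs := hvM M ((le_max_left _ _).trans (le_max_right _ _))
  have hws := hwM M ((le_max_right _ _).trans (le_max_right _ _))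
  obtain ⟨-, -, -, hvc, hv0, -⟩ := hv
  obtain ⟨-, -, -, hwc, hw0, -⟩ := hw
  have hvL := hvs.memLp_rpow hΩv hq
  have hwL := hws.memLp_rpow hΩv hq
  have hUc := hvc.sub hwc
  have hUd := hvd.sub (hvL.integrable (by norm_num)) (hvs.deriv.integrable (by norm_num))
    (hwL.integrable (by norm_num)) (hws.deriv.integrable (by norm_num)) hwd
  have hU0 : eLpNorm (fun x => v₀ x ^ q - w₀ x ^ q) 2 (volume.restrict Ω) =
      eLpNorm (fun x => v 0 x ^ q - w 0 x ^ q) 2 (volume.restrict Ω) := by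
    refine eLpNorm_congr_ae ?_
    filter_upwards [hv0, hw0] with x h1 h2
    rw [h1, h2]
  rw [hU0]
  refine DNE.eLpNorm_le_of_energy_inequality hT (hh.sub hh') (hvL.sub hwL) hUc
    (fun s hs => ?_) ht
  rw [DNE.energy_identity hT hΩ hΩv hUc (hvL.sub hwL) (hvs.deriv.sub hws.deriv) hUd
    ⟨hs.1.le, hs.2⟩]
  have h1 := DNE.integral_deriv_le_integral_potential hq hM hΩ hΩb hqpΩ hpm hpP hA hf hvs hws hs
  linarith
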